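/- Let $a>0$, $b>0$, $E>0$ be fixed and, for $\gamma\in\mathbb R$, consider the planar system $$\psi' = v,\qquad v' = 2\bigl(\gamma+a\psi^2-b\psi^4\bigr)v-2E\psi .$$ At $\gamma=0$ the equilibrium $(0,0)$ undergoes a Hopf bifurcation with linear frequency $\sqrt{2E}$ (a pair of complex conjugate eigenvalues of the Jacobian at the origin, equal to $\pm i\sqrt{2E}$ at $\gamma=0$, crosses the imaginary axis with nonzero speed), and this bifurcation is subcritical in the following sense. There exist $\varepsilon>0$ and, for every $\gamma\in(-\varepsilon,0)$, a limit cycle (isolated closed orbit) $\Gamma_{\mathrm{in}}(\gamma)$ of the system such that: 1. the origin is asymptotically stable for $\gamma\in(-\varepsilon,0)$ and unstable for $\gamma\in(0,\varepsilon)$; 2. for every $\gamma\in(-\varepsilon,0)$ the cycle $\Gamma_{\mathrm{in}}(\gamma)$ surrounds the origin and is unstable and, more precisely, repelling (asymptotically orbitally stable for the time-reversed system); 3. $\Gamma_{\mathrm{in}}(\gamma)$ shrinks to the origin as $\gamma\to0^-$, and its amplitude $A_{\mathrm{in}}(\gamma)$, that is, the common value of $|\psi|$ at the points of $\Gamma_{\mathrm{in}}(\gamma)$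 with $v=0$, satisfies $$A_{\mathrm{in}}^2(\gamma)=-\frac{4\gamma}{a}+\mathcal O(\gamma^2),\qquad \gamma\to0^- .$$ -/

import Mathlib

open Set Filter Topology Asymptotics

/-! Autonomous ordinary differential equations `c' = f(c)`: solutions are Mathlib's
`IsIntegralCurve` / `IsIntegralCurveOn` of the time-independent vector field `fun _ ↦ f`. -/

section Dynamics

variable {P : Type*} [NormedAddCommGroup P] [NormedSpace ℝ P]

/-- `K` is (Lyapunov, orbitally) stable for `c' = f(c)`: solutions that start close to `K` stay
close to `K` for as long as they exist in forward time. -/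
def IsStableSet (f : P → P) (K : Set P) : Prop :=
  ∀ V ∈ 𝓝ˢ K, ∃ U ∈ 𝓝ˢ K, ∀ (c : ℝ → P) (T : ℝ),
    IsIntegralCurveOn c (fun _ => f) (Icc 0 T) → c 0 ∈ U → ∀ t ∈ Icc 0 T, c t ∈ V

/-- Every point near `K` is the start of a solution that exists for all forward time and
converges to `K`. -/
def IsAttractingSet (f : P → P) (K : Set P) : Prop :=
  ∃ U ∈ 𝓝ˢ K, ∀ x ∈ U, ∃ c : ℝ → P,
    c 0 = x ∧ IsIntegralCurveOn c (fun _ => f) (Ici 0) ∧ Tendsto c atTop (𝓝ˢ K)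

/-- Asymptotic (orbital) stability of `K` for `c' = f(c)`. -/
def IsAsymptoticallyStableSet (f : P → P) (K : Set P) : Prop :=
  IsStableSet f K ∧ IsAttractingSet f K

/-- `K` is repelling for `c' = f(c)`: it is asymptotically stable for the time-reversed
equation `c' = -f(c)`. -/
def IsRepellingSet (f : P → P) (K : Set P) : Prop :=
  IsAsymptoticallyStableSet (fun x => -f x) K

/-- `Γ` is a closed orbit of `c' = f(c)`: the image of a nonconstant periodic solution. -/
def IsPeriodicOrbit (f : P → P) (Γ : Set P) : Prop :=
  ∃ (c : ℝ → P) (T : ℝ), 0 < T ∧ IsIntegralCurve c (fun _ => f) ∧ Function.Periodic c T ∧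
    (∃ t, c t ≠ c 0) ∧ range c = Γ

/-- A limit cycle: a closed orbit that is isolated among the closed orbits. -/
def IsLimitCycle (f : P → P) (Γ : Set P) : Prop :=
  IsPeriodicOrbit f Γ ∧ ∃ U ∈ 𝓝ˢ Γ, ∀ Γ' : Set P, IsPeriodicOrbit f Γ' → Γ' ⊆ U → Γ' = Γ

/-- The point `p` lies inside `Γ`: it is not on `Γ`, and its connected component in the complement
of `Γ` is bounded. -/
def Surrounds (Γ : Set P) (p : P) : Prop :=
  p ∉ Γ ∧ Bornology.IsBounded (connectedComponentIn Γᶜ p)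

/-- The smooth one-parameter family of planar systems `c' = f μ c` undergoes a Hopf bifurcation
at the equilibrium `p` for `μ = μ₀`, with linear frequency `ω > 0`: the Jacobian at `p` has an
eigenvalue `lam μ` (and hence its conjugate) which at `μ₀` equals `i ω` and crosses the imaginary
axis with nonzero speed. -/
def IsHopfBifurcation (f : ℝ → ℝ × ℝ → ℝ × ℝ) (μ₀ : ℝ) (p : ℝ × ℝ) (ω : ℝ) : Prop :=
  ContDiff ℝ ((⊤ : ℕ∞) : WithTop ℕ∞) (fun q : ℝ × (ℝ × ℝ) => f q.1 q.2) ∧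
  (∀ᶠ μ in 𝓝 μ₀, f μ p = 0) ∧ 0 < ω ∧
  ∃ (lam : ℝ → ℂ) (d : ℂ),
    (∀ᶠ μ in 𝓝 μ₀,
      (((fderiv ℝ (f μ) p).toLinearMap.charpoly).map (algebraMap ℝ ℂ)).IsRoot (lam μ)) ∧
    lam μ₀ = ω * Complex.I ∧ HasDerivAt lam d μ₀ ∧ d.re ≠ 0

end Dynamics

/-- The vector field of the planar system
`ψ' = v`, `v' = 2 (γ + a ψ² - b ψ⁴) v - 2 E ψ`, at the point `(ψ, v)`. -/
def planarField (a b E γ : ℝ) (z : ℝ × ℝ) : ℝ × ℝ :=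
  (z.2, 2 * (γ + a * z.1 ^ 2 - b * z.1 ^ 4) * z.2 - 2 * E * z.1)

/-- `A` is the amplitude of the cycle `Γ` in the `(ψ, v)` plane: `Γ` has turning points, that is
points with `v = 0`, and `|ψ| = A` at each of them. -/
def HasAmplitude (Γ : Set (ℝ × ℝ)) (A : ℝ) : Prop :=
  (∃ ψ : ℝ, (ψ, 0) ∈ Γ) ∧ ∀ ψ : ℝ, (ψ, 0) ∈ Γ → |ψ| = A

/-! Put `ω = √(2E)`, `γ = -ω e`, `ψ = r cos θ`, `v = -ω r sin θ` and `r² = (ω e / a) y`. For small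
`e > 0` the angle increases near `y = 4`, and the system reduces to a scalar equation `dy/dθ = e G`.
At `e = 0` the rate is `G = 4 y sin²θ (y cos²θ - 1)`, with integral `(π/2) y (y - 4)` over half a
turn. The averaged equation thus has the zero `y = 4`, with positive derivative: a repelling cycle
with `ψ² ≈ 4 ω e / a = -4γ/a` at its turning points.

Existence (`exists_periodic_polar_solution`): the half-turn displacement equals its average up to `C
e²`, so it has opposite signs at `4 - C e` and `4 + C e`. The intermediate value theorem gives a
`π`-periodic solution `Y` with `|Y 0 - 4| ≤ C e`, which is the amplitude estimate.

Repulsion and isolation: `∂G/∂y` is close to an oscillating function of mean 2. A Floquet weight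
absorbs the oscillation, so the square of the weighted distance `y - Y(θ)` decays exponentially in
reversed time (`IsPolarCycle.isStrictLyapunov`). The general theory of `IsStrictLyapunov` then gives
asymptotic stability in reversed time and excludes other closed orbits nearby.

The origin is treated by the same theory, with a quadratic form that the linearised flow multiplies
by `exp (2 γ t)` (`isStrictLyapunov_originEnergy`). -/

/-! ### Global solutions of Lipschitz and truncated equations. -/

section GlobalExistence

variable {P : Type*} [NormedAddCommGroup P] [NormedSpace ℝ P]

/-- A bounded vector field that is Lipschitz in space has solutions for all times. -/
theorem exists_isIntegralCurve_of_lipschitz_of_bounded [CompleteSpace P] {F : ℝ → P → P}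
    {K L : NNReal} (hK : ∀ t, LipschitzWith K (F t)) (hcont : ∀ x, Continuous (fun t => F t x))
    (hL : ∀ t x, ‖F t x‖ ≤ L) (x₀ : P) : ∃ c : ℝ → P, c 0 = x₀ ∧ IsIntegralCurve c F := by
  have loc : ∀ n : ℕ, ∃ α : ℝ → P, α 0 = x₀ ∧ ∀ t ∈ Icc (-(n : ℝ)) n,
      HasDerivWithinAt α (F t (α t)) (Icc (-(n : ℝ)) n) t := by
    intro n
    have h0 : (0 : ℝ) ∈ Icc (-(n : ℝ)) n := by simp
    -- A solution of speed at most `L` moves at most `L n` in time `n`, so the ball of radius `L n`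
    -- serves on the whole interval.
    have hp : IsPicardLindelof F (⟨0, h0⟩ : Icc (-(n : ℝ)) n) x₀ (L * n) 0 L K :=
      { lipschitzOnWith := fun t _ => (hK t).lipschitzOnWith
        continuousOn := fun x _ => (hcont x).continuousOn
        norm_le := fun t _ x _ => hL t x
        mul_max_le := by simp }
    exact hp.exists_eq_forall_mem_Icc_hasDerivWithinAt₀
  choose α hα0 hα using loc
  have hder : ∀ (n : ℕ) (t : ℝ), t ∈ Ioo (-(n : ℝ)) n → HasDerivAt (α n) (F t (α n t)) t :=
    fun n t ht => (hα n t (Ioo_subset_Icc_self ht)).hasDerivAt (Icc_mem_nhds ht.1 ht.2)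
  have agree : ∀ (m n : ℕ), 0 < m → m ≤ n → EqOn (α m) (α n) (Icc (-(m : ℝ)) m) := by
    intro m n hm hmn
    have hm' : (0 : ℝ) < m := by exact_mod_cast hm
    have hmn' : (m : ℝ) ≤ n := by exact_mod_cast hmn
    have hsub : Icc (-(m : ℝ)) m ⊆ Icc (-(n : ℝ)) n := Icc_subset_Icc (by linarith) hmn'
    refine ODE_solution_unique_of_mem_Icc (v := F) (s := fun _ => univ) (K := K) (t₀ := 0)
      (fun t _ => (hK t).lipschitzOnWith) ⟨by linarith, hm'⟩
      (fun t ht => (hα m t ht).continuousWithinAt) (hder m) (fun _ _ => mem_univ _)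
      (fun t ht => ((hα n t (hsub ht)).continuousWithinAt.mono hsub))
      (fun t ht => hder n t ⟨by linarith [ht.1], by linarith [ht.2]⟩) (fun _ _ => mem_univ _) ?_
    rw [hα0, hα0]
  -- The `+ 1` puts `t` in the open interval `(-N t, N t)`, where the derivative is two-sided.
  let N : ℝ → ℕ := fun t => ⌈|t|⌉₊ + 1
  have hN : ∀ t, |t| < N t := fun t => by
    have := Nat.le_ceil |t|
    simp only [N]; push_cast; linarith
  refine ⟨fun t => α (N t) t, hα0 _, fun t => ?_⟩
  have ht := hN t
  have hev : (fun t => α (N t) t) =ᶠ[𝓝 t] α (N t) := by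
    have hopen : {r : ℝ | |r| < N t} ∈ 𝓝 t := (isOpen_lt continuous_abs continuous_const).mem_nhds ht
    filter_upwards [hopen] with r hr
    have hr' := hN r
    rcases le_total (N r) (N t) with h | h
    · exact agree _ _ (Nat.succ_pos _) h (abs_le.1 hr'.le)
    · exact (agree _ _ (Nat.succ_pos _) h (abs_le.1 (le_of_lt hr))).symm
  exact (hder (N t) t (abs_lt.1 ht)).congr_of_eventuallyEq hev

/-- A `C¹` vector field can be changed outside a compact set so that all solutions are global. -/
theorem exists_globalized_field [FiniteDimensional ℝ P] {f : P → P} (hf : ContDiff ℝ 1 f)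
    {S : Set P} (hS : IsCompact S) :
    ∃ g : P → P, (∀ x ∈ S, g x = f x) ∧
      ∀ x, ∃ c : ℝ → P, c 0 = x ∧ IsIntegralCurve c (fun _ => g) := by
  obtain ⟨r, hr⟩ := hS.isBounded.subset_closedBall 0
  let φ : ContDiffBump (0 : P) := ⟨max r 1, max r 1 + 1, by positivity, by linarith⟩
  have hφ : ContDiff ℝ 1 (fun x => φ x • f x) := φ.contDiff.smul hf
  have hsupp : HasCompactSupport (fun x => φ x • f x) := φ.hasCompactSupport.smul_right
  obtain ⟨K, hK⟩ : ∃ K, LipschitzWith K (fun x => φ x • f x) :=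
    hφ.lipschitzWith_of_hasCompactSupport hsupp (by simp)
  obtain ⟨L, hL⟩ := hφ.continuous.bounded_above_of_compact_support hsupp
  refine ⟨fun x => φ x • f x, fun x hx => ?_, fun x => ?_⟩
  · have : φ x = 1 := φ.one_of_mem_closedBall
      (Metric.closedBall_subset_closedBall (le_max_left _ _) (hr hx))
    simp [this]
  · have := FiniteDimensional.complete ℝ P
    exact exists_isIntegralCurve_of_lipschitz_of_bounded (L := L.toNNReal) (fun _ => hK)
      (fun _ => continuous_const) (fun _ x => (hL x).trans (Real.le_coe_toNNReal L)) x

end GlobalExistence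

/-! ### Strict Lyapunov functions, stability and closed orbits. -/

section Lyapunov

/-- A function that decays exponentially as long as it lies below a threshold decays forever, once
it starts below the threshold. -/
theorem le_mul_exp_of_decay_below {φ : ℝ → ℝ} {κ μ T : ℝ} (hμ : 0 ≤ μ)
    (hnn : ∀ t, 0 ≤ φ t) (hcont : ContinuousOn φ (Icc 0 T))
    (hd : ∀ t ∈ Icc 0 T, φ t < κ → ∃ d, HasDerivWithinAt φ d (Icc 0 T) t ∧ d ≤ -μ * φ t)
    (h0 : φ 0 < κ) : ∀ t ∈ Icc 0 T, φ t < κ ∧ φ t ≤ φ 0 * Real.exp (-μ * t) := by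
  have key : ∀ τ ∈ Icc 0 T, (∀ t ∈ Ico 0 τ, φ t < κ) → φ τ ≤ φ 0 * Real.exp (-μ * τ) := by
    intro τ hτ hlt
    have hsub : Icc 0 τ ⊆ Icc 0 T := Icc_subset_Icc le_rfl hτ.2
    choose! d hd1 hd2 using hd
    have hanti : AntitoneOn (fun t => φ t * Real.exp (μ * t)) (Icc 0 τ) := by
      refine antitoneOn_of_hasDerivWithinAt_nonpos (convex_Icc 0 τ)
        (f' := fun t => d t * Real.exp (μ * t) + φ t * (Real.exp (μ * t) * μ))
        ((hcont.mono hsub).mul (by fun_prop)) ?_ ?_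
      · intro t ht
        rw [interior_Icc] at ht ⊢
        have h1 := (hd1 t (hsub (Ioo_subset_Icc_self ht)) (hlt t ⟨ht.1.le, ht.2⟩)).mono
          (Ioo_subset_Icc_self.trans hsub)
        have h2 : HasDerivAt (fun t : ℝ => Real.exp (μ * t)) (Real.exp (μ * t) * μ) t := by
          simpa using ((hasDerivAt_id t).const_mul μ).exp
        exact h1.mul h2.hasDerivWithinAt
      · intro t ht
        rw [interior_Icc] at ht
        have h1 := hd2 t (hsub (Ioo_subset_Icc_self ht)) (hlt t ⟨ht.1.le, ht.2⟩)
        nlinarith [Real.exp_pos (μ * t)]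
    have h := hanti (left_mem_Icc.2 hτ.1) (right_mem_Icc.2 hτ.1) hτ.1
    simp only [mul_zero, Real.exp_zero, mul_one] at h
    calc φ τ = φ τ * Real.exp (μ * τ) * Real.exp (-μ * τ) := by
          rw [mul_assoc, ← Real.exp_add]; simp
      _ ≤ _ := mul_le_mul_of_nonneg_right h (Real.exp_pos _).le
  have hbelow : ∀ t ∈ Icc 0 T, φ t < κ := by
    by_contra! hcon
    obtain ⟨t₁, ht₁, hφ₁⟩ := hcon
    -- At the first time of reaching `κ`, the decay valid up to that time already gives a value
    -- below `κ`.
    let S := Icc 0 T ∩ φ ⁻¹' (Ici κ)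
    have hScl : IsClosed S := hcont.preimage_isClosed_of_isClosed isClosed_Icc isClosed_Ici
    have hSbdd : BddBelow S := ⟨0, fun t ht => ht.1.1⟩
    have hmem : sInf S ∈ S := hScl.csInf_mem ⟨t₁, ht₁, hφ₁⟩ hSbdd
    have hle := key _ hmem.1 (fun t ht => by
      by_contra! hge
      exact absurd (csInf_le hSbdd (show t ∈ S from ⟨⟨ht.1, ht.2.le.trans hmem.1.2⟩, hge⟩))
        (not_le.2 ht.2))
    have h1 : Real.exp (-μ * sInf S) ≤ 1 := Real.exp_le_one_iff.2 (by nlinarith [hmem.1.1])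
    have h2 : κ ≤ φ (sInf S) := hmem.2
    nlinarith [hnn 0]
  exact fun t ht => ⟨hbelow t ht, key t ht fun r hr => hbelow r ⟨hr.1, hr.2.le.trans ht.2⟩⟩

variable {P : Type*} [NormedAddCommGroup P] [NormedSpace ℝ P]

/-- Strict Lyapunov functions: `Φ` is nonnegative, continuous, has compact sublevel sets below
`κ`, and decays along `f` at an exponential rate where it is less than `κ`. -/
structure IsStrictLyapunov (f : P → P) (Φ : P → ℝ) (κ μ : ℝ) : Prop where
  continuous : Continuous Φ
  nonneg : ∀ z, 0 ≤ Φ z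
  pos : 0 < κ
  rate_pos : 0 < μ
  isCompact : ∀ k < κ, IsCompact {z | Φ z ≤ k}
  decay : ∀ z, Φ z < κ → ∃ Φ' : P →L[ℝ] ℝ, HasFDerivAt Φ Φ' z ∧ Φ' (f z) ≤ -μ * Φ z

namespace IsStrictLyapunov

variable {f : P → P} {Φ : P → ℝ} {κ μ : ℝ}

theorem decay_of_isIntegralCurveOn (h : IsStrictLyapunov f Φ κ μ) {g : P → P}
    {κ' : ℝ} (hκ' : κ' ≤ κ) (hg : ∀ z, Φ z < κ' → g z = f z) {c : ℝ → P} {T : ℝ}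
    (hc : IsIntegralCurveOn c (fun _ => g) (Icc 0 T)) (h0 : Φ (c 0) < κ') :
    ∀ t ∈ Icc 0 T, Φ (c t) < κ' ∧ Φ (c t) ≤ Φ (c 0) * Real.exp (-μ * t) := by
  refine le_mul_exp_of_decay_below (φ := fun t => Φ (c t)) h.rate_pos.le (fun t => h.nonneg _)
    (h.continuous.comp_continuousOn hc.continuousOn) (fun t ht hlt => ?_) h0
  obtain ⟨Φ', hΦ', hle⟩ := h.decay (c t) (hlt.trans_le hκ')
  have hct := hc t ht
  simp only [hg _ hlt] at hct
  exact ⟨_, hΦ'.comp_hasDerivWithinAt t hct, hle⟩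

theorem exists_sublevel_subset (h : IsStrictLyapunov f Φ κ μ) {V : Set P}
    (hV : V ∈ 𝓝ˢ {z | Φ z = 0}) : ∃ k, 0 < k ∧ k < κ ∧ {z | Φ z ≤ k} ⊆ V := by
  have hκ := h.pos
  have hcomp : IsCompact ({z | Φ z ≤ κ / 2} \ interior V) :=
    (h.isCompact _ (half_lt_self hκ)).diff isOpen_interior
  rcases ({z | Φ z ≤ κ / 2} \ interior V).eq_empty_or_nonempty with he | hne
  · exact ⟨κ / 2, half_pos hκ, half_lt_self hκ, (sdiff_eq_empty.1 he).trans interior_subset⟩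
  · obtain ⟨z₀, hz₀, hmin⟩ := hcomp.exists_isMinOn hne h.continuous.continuousOn
    have hpos : 0 < Φ z₀ := by
      refine (h.nonneg z₀).lt_of_ne fun h0 => hz₀.2 ?_
      exact subset_interior_iff_mem_nhdsSet.2 hV h0.symm
    refine ⟨min (κ / 2) (Φ z₀ / 2), by positivity, (min_le_left _ _).trans_lt (half_lt_self hκ),
      fun z hz => ?_⟩
    by_contra hzV
    have h1 : z ∈ {z | Φ z ≤ κ / 2} \ interior V :=
      ⟨le_trans (show Φ z ≤ _ from hz) (min_le_left _ _), fun hi => hzV (interior_subset hi)⟩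
    have h2 : Φ z₀ ≤ Φ z := hmin h1
    have h3 : Φ z ≤ Φ z₀ / 2 := le_trans hz (min_le_right _ _)
    linarith

theorem sublevel_mem_nhdsSet (h : IsStrictLyapunov f Φ κ μ) {k : ℝ} (hk : 0 < k) :
    {z | Φ z < k} ∈ 𝓝ˢ {z | Φ z = 0} :=
  (isOpen_lt h.continuous continuous_const).mem_nhdsSet.2 fun z (hz : Φ z = 0) => by
    simpa [hz] using hk

theorem isAsymptoticallyStableSet [FiniteDimensional ℝ P] (h : IsStrictLyapunov f Φ κ μ)
    (hf : ContDiff ℝ 1 f) : IsAsymptoticallyStableSet f {z | Φ z = 0} := by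
  have hκ := h.pos
  constructor
  · intro V hV
    obtain ⟨k, hk, hkκ, hkV⟩ := h.exists_sublevel_subset hV
    exact ⟨_, h.sublevel_mem_nhdsSet hk, fun c T hc h0 t ht => hkV
      (h.decay_of_isIntegralCurveOn hkκ.le (fun _ _ => rfl) hc h0 t ht).1.le⟩
  -- The trajectories of `g` never leave the sublevel set on which `g = f`, so they are global
  -- forward trajectories of `f`.
  · obtain ⟨g, hg, hsol⟩ := exists_globalized_field hf (h.isCompact _ (half_lt_self hκ))
    refine ⟨_, h.sublevel_mem_nhdsSet (half_pos hκ), fun x hx => ?_⟩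
    obtain ⟨c, hc0, hc⟩ := hsol x
    have hdec : ∀ t, 0 ≤ t → Φ (c t) < κ / 2 ∧ Φ (c t) ≤ Φ (c 0) * Real.exp (-μ * t) :=
      fun t ht => h.decay_of_isIntegralCurveOn (half_lt_self hκ).le (fun z hz => hg z hz.le)
        (hc.isIntegralCurveOn (Icc 0 t)) (by rw [hc0]; exact hx) t ⟨ht, le_rfl⟩
    refine ⟨c, hc0, fun t ht => ?_, ?_⟩
    · have := (hc t).hasDerivWithinAt (s := Ici 0)
      simpa only [hg _ (hdec t ht).1.le] using this
    · have hlim : Tendsto (fun t => Φ (c 0) * Real.exp (-μ * t)) atTop (𝓝 0) := by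
        have h1 : Tendsto (fun t : ℝ => -μ * t) atTop atBot :=
          tendsto_id.const_mul_atTop_of_neg (by linarith [h.rate_pos])
        simpa using (Real.tendsto_exp_atBot.comp h1).const_mul (Φ (c 0))
      refine tendsto_def.2 fun V hV => ?_
      obtain ⟨k, hk, -, hkV⟩ := h.exists_sublevel_subset hV
      filter_upwards [hlim.eventually (gt_mem_nhds hk), eventually_ge_atTop 0] with t ht ht0
      exact hkV ((hdec t ht0).2.trans ht.le)

/-- Closed orbits in the region where a strict Lyapunov function decays lie in its zero set. -/
theorem subset_zero_of_isPeriodicOrbit (h : IsStrictLyapunov f Φ κ μ) {Γ : Set P}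
    (hΓ : IsPeriodicOrbit f Γ) (hsub : Γ ⊆ {z | Φ z < κ}) : Γ ⊆ {z | Φ z = 0} := by
  obtain ⟨c, T, hT, hc, hper, -, rfl⟩ := hΓ
  rintro _ ⟨s, rfl⟩
  have hshift : IsIntegralCurveOn (fun t => c (t + s)) (fun _ => f) (Icc 0 T) :=
    fun t _ => ((hc (t + s)).comp_add_const t s).hasDerivWithinAt
  have h1 := (h.decay_of_isIntegralCurveOn le_rfl (fun _ _ => rfl) hshift
    (hsub (mem_range_self _)) T ⟨hT.le, le_rfl⟩).2
  -- After one period the value of `Φ` has returned, yet it was multiplied by a factor less than 1;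
  -- so it is 0.
  have h2 : c (T + s) = c s := by rw [add_comm]; exact hper s
  simp only [zero_add, h2] at h1
  have h3 : Real.exp (-μ * T) < 1 := Real.exp_lt_one_iff.2 (by nlinarith [h.rate_pos])
  have h4 := h.nonneg (c s)
  show Φ (c s) = 0
  nlinarith

end IsStrictLyapunov

/-- A closed set that attracts in backward time is not stable in forward time. -/
theorem IsAttractingSet.not_isStableSet_neg {f : P → P} {K : Set P}
    (h : IsAttractingSet (fun x => -f x) K) {z : P} (hz : z ∈ K) (hz' : z ∈ closure Kᶜ) :
    ¬ IsStableSet f K := by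
  intro hst
  obtain ⟨U, hU, hsol⟩ := h
  have hUz : U ∈ 𝓝 z := mem_nhdsSet_iff_forall.1 hU z hz
  obtain ⟨x, hxU, hxK⟩ := mem_closure_iff_nhds.1 hz' U hUz
  obtain ⟨c, hc0, hc, hlim⟩ := hsol x hxU
  -- Reversing a trajectory that tends from `x` to `K` gives forward trajectories that start
  -- arbitrarily close to `K` and still reach `x`, hence leave this neighbourhood.
  have hV : ({x}ᶜ : Set P) ∈ 𝓝ˢ K :=
    isOpen_compl_singleton.mem_nhdsSet.2 fun y hy hyx => hxK (hyx ▸ hy)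
  obtain ⟨W, hW, hstay⟩ := hst _ hV
  obtain ⟨T, hT, hT0⟩ := ((hlim.eventually hW).and (eventually_ge_atTop 0)).exists
  refine hstay (fun t => c (T - t)) T (fun t ht => ?_) (by simpa using (show c T ∈ W from hT)) T ⟨hT0, le_rfl⟩
    (by simp [hc0])
  have h1 := hc (T - t) (by simpa using ht.2)
  have h2 : HasDerivWithinAt (fun t => T - t) (-1) (Icc 0 T) t :=
    ((hasDerivAt_id t).const_sub T).hasDerivWithinAt
  have h3 := h1.scomp t h2 (fun r hr => by simpa using hr.2)
  simpa [Function.comp_def] using h3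

/-- Closed orbits of a `C¹` vector field with a common point coincide. -/
theorem IsPeriodicOrbit.eq_of_mem {f : P → P} (hf : ContDiff ℝ 1 f) {Γ Γ' : Set P}
    (h : IsPeriodicOrbit f Γ) (h' : IsPeriodicOrbit f Γ') {z : P} (hz : z ∈ Γ) (hz' : z ∈ Γ') :
    Γ = Γ' := by
  obtain ⟨c, T, hT, hc, hper, -, rfl⟩ := h
  obtain ⟨c', T', hT', hc', hper', -, rfl⟩ := h'
  obtain ⟨s, rfl⟩ := hz
  obtain ⟨s', hs'⟩ := hz'
  have hcomp : ∀ {c : ℝ → P} {T : ℝ}, 0 < T → IsIntegralCurve c (fun _ => f) →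
      Function.Periodic c T → IsCompact (range c) := fun hT hc hper => by
    rw [← hper.image_Icc hT 0]; exact isCompact_Icc.image hc.continuous
  obtain ⟨K, hK⟩ := (hf.locallyLipschitz.locallyLipschitzOn
    (s := range c ∪ range c')).exists_lipschitzOnWith_of_compact
      ((hcomp hT hc hper).union (hcomp hT' hc' hper'))
  have heq : (fun t => c (t + s)) = fun t => c' (t + s') :=
    ODE_solution_unique_univ (t₀ := 0) (v := fun _ => f) (s := fun _ => range c ∪ range c')
      (fun _ => hK) (fun t => ⟨(hc (t + s)).comp_add_const t s, Or.inl (mem_range_self _)⟩)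
      (fun t => ⟨(hc' (t + s')).comp_add_const t s', Or.inr (mem_range_self _)⟩)
      (by simpa using hs'.symm)
  apply Subset.antisymm
  · rintro _ ⟨t, rfl⟩
    have := congrFun heq (t - s)
    simp only [sub_add_cancel] at this
    exact this ▸ mem_range_self _
  · rintro _ ⟨t, rfl⟩
    have := congrFun heq (t - s')
    simp only [sub_add_cancel] at this
    exact this ▸ mem_range_self _

theorem IsPeriodicOrbit.neg {f : P → P} {Γ : Set P} (h : IsPeriodicOrbit f Γ) :
    IsPeriodicOrbit (fun x => -f x) Γ := by
  obtain ⟨c, T, hT, hc, hper, ⟨t, ht⟩, rfl⟩ := h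
  refine ⟨fun t => c (-t), T, hT, fun t => ?_, fun t => ?_, ⟨-t, by simpa using ht⟩, ?_⟩
  · simpa [Function.comp_def] using (hc (-t)).scomp t (hasDerivAt_neg t)
  · have := hper.neg (-t)
    simpa only [neg_add] using this
  · exact (Equiv.neg ℝ).surjective.range_comp c

theorem IsStrictLyapunov.isLimitCycle {f : P → P} {Φ : P → ℝ} {κ μ : ℝ}
    (h : IsStrictLyapunov (fun x => -f x) Φ κ μ) (hf : ContDiff ℝ 1 f)
    (hΓ : IsPeriodicOrbit f {z | Φ z = 0}) : IsLimitCycle f {z | Φ z = 0} := by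
  refine ⟨hΓ, _, h.sublevel_mem_nhdsSet h.pos, fun Γ' hΓ' hsub => ?_⟩
  have h0 := h.subset_zero_of_isPeriodicOrbit hΓ'.neg hsub
  obtain ⟨c, T, hT, hc, hper, ht, hr⟩ := id hΓ'
  have hmem : c 0 ∈ Γ' := hr ▸ mem_range_self _
  exact hΓ'.eq_of_mem hf hΓ hmem (h0 hmem)

end Lyapunov

/-! ### The Hopf eigenvalues and the stability of the origin. -/

section Origin

theorem contDiff_planarField (a b E γ : ℝ) {n : WithTop ℕ∞} : ContDiff ℝ n (planarField a b E γ) := by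
  unfold planarField; fun_prop

theorem hasFDerivAt_planarField_zero (a b E γ : ℝ) :
    HasFDerivAt (planarField a b E γ) ((ContinuousLinearMap.snd ℝ ℝ ℝ).prod
      ((2 * γ) • ContinuousLinearMap.snd ℝ ℝ ℝ - (2 * E) • ContinuousLinearMap.fst ℝ ℝ ℝ)) 0 := by
  unfold planarField
  refine hasFDerivAt_snd.prodMk ?_
  have h1 : HasFDerivAt (fun z : ℝ × ℝ => z.1) (ContinuousLinearMap.fst ℝ ℝ ℝ) 0 := hasFDerivAt_fst
  have h2 : HasFDerivAt (fun z : ℝ × ℝ => z.2) (ContinuousLinearMap.snd ℝ ℝ ℝ) 0 := hasFDerivAt_snd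
  have h := ((((((h1.pow 2).const_mul a).const_add γ).sub ((h1.pow 4).const_mul b)).const_mul
    2).mul h2).sub (h1.const_mul (2 * E))
  refine h.congr_fderiv ?_
  ext <;> simp

theorem charpoly_fderiv_planarField_zero (a b E γ : ℝ) :
    (fderiv ℝ (planarField a b E γ) 0).toLinearMap.charpoly =
      Polynomial.X ^ 2 - Polynomial.C (2 * γ) * Polynomial.X + Polynomial.C (2 * E) := by
  rw [(hasFDerivAt_planarField_zero a b E γ).fderiv,
    ← LinearMap.charpoly_toMatrix _ (Module.Basis.finTwoProd ℝ), Matrix.charpoly_fin_two,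
    Matrix.det_fin_two]
  simp [LinearMap.toMatrix_apply, Matrix.trace_fin_two]

theorem isHopfBifurcation_planarField (a b : ℝ) {E : ℝ} (hE : 0 < E) :
    IsHopfBifurcation (planarField a b E) 0 0 (Real.sqrt (2 * E)) := by
  refine ⟨by unfold planarField; fun_prop, Eventually.of_forall fun γ => by simp [planarField],
    Real.sqrt_pos.2 (by positivity), fun γ => (γ : ℂ) + (Real.sqrt (2 * E - γ ^ 2) : ℝ) * Complex.I,
    1, ?_, by simp, ?_, by simp⟩
  · have hev : ∀ᶠ γ : ℝ in 𝓝 0, γ ^ 2 < 2 * E :=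
      (continuous_pow 2).continuousAt.eventually_lt continuousAt_const (by simpa using hE)
    filter_upwards [hev] with γ hγ
    have hsq : ((Real.sqrt (2 * E - γ ^ 2) : ℝ) : ℂ) ^ 2 = 2 * E - γ ^ 2 := by
      rw [← Complex.ofReal_pow, Real.sq_sqrt (by linarith)]; push_cast; ring
    rw [charpoly_fderiv_planarField_zero]
    simp only [Polynomial.IsRoot, Polynomial.map_add, Polynomial.map_sub, Polynomial.map_mul,
      Polynomial.map_pow, Polynomial.map_X, Polynomial.map_C, Polynomial.eval_add,
      Polynomial.eval_sub, Polynomial.eval_mul, Polynomial.eval_pow, Polynomial.eval_X,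
      Polynomial.eval_C, Complex.coe_algebraMap]
    push_cast
    linear_combination (Complex.I ^ 2) * hsq + (2 * (E : ℂ) - γ ^ 2) * Complex.I_sq
  · have h1 : HasDerivAt (fun γ : ℝ => Real.sqrt (2 * E - γ ^ 2)) 0 0 := by
      have h2 : HasDerivAt (fun γ : ℝ => 2 * E - γ ^ 2) 0 0 := by
        simpa using (hasDerivAt_pow 2 (0 : ℝ)).const_sub (2 * E)
      simpa using h2.sqrt (by simpa using hE.ne')
    have h3 := (hasDerivAt_id (0 : ℝ)).ofReal_comp.add (h1.ofReal_comp.mul_const Complex.I)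
    convert! h3 using 1
    simp

theorem hasFDerivAt_originEnergy (E γ : ℝ) (z : ℝ × ℝ) :
    HasFDerivAt (fun z : ℝ × ℝ => 2 * E * z.1 ^ 2 + z.2 ^ 2 - 2 * γ * (z.1 * z.2))
      ((4 * E * z.1 - 2 * γ * z.2) • ContinuousLinearMap.fst ℝ ℝ ℝ +
        (2 * z.2 - 2 * γ * z.1) • ContinuousLinearMap.snd ℝ ℝ ℝ) z := by
  have h1 : HasFDerivAt (fun z : ℝ × ℝ => z.1) (ContinuousLinearMap.fst ℝ ℝ ℝ) z := hasFDerivAt_fst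
  have h2 : HasFDerivAt (fun z : ℝ × ℝ => z.2) (ContinuousLinearMap.snd ℝ ℝ ℝ) z := hasFDerivAt_snd
  refine ((((h1.pow 2).const_mul (2 * E)).add (h2.pow 2)).sub
    ((h1.mul h2).const_mul (2 * γ))).congr_fderiv ?_
  ext
  · simp; ring
  · simp

/-- The form `2Eψ² + v²` alone does not decay where `v = 0`. With the cross term `-2γψv` the
derivative along the linear part is exactly `2γ` times the form. The nonlinear terms cost part of
this rate, which leaves `-(σγ)/2`. The sign `σ` selects the direction of time, covering `γ < 0` and
`γ > 0` together. -/
theorem isStrictLyapunov_originEnergy {a b E γ σ : ℝ} (ha : 0 < a) (hb : 0 < b) (hE : 0 < E)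
    (hσ : σ ^ 2 = 1) (hσγ : σ * γ < 0) (hγ : γ ^ 2 ≤ E / 32) :
    IsStrictLyapunov (fun z => σ • planarField a b E γ z)
      (fun z : ℝ × ℝ => 2 * E * z.1 ^ 2 + z.2 ^ 2 - 2 * γ * (z.1 * z.2))
      (E * min 1 (-(σ * γ) / (8 * (a + b)))) (-(σ * γ) / 2) := by
  -- By the inequality of means, `γ² ≤ E/32` is exactly what makes the cross term at most one eighth
  -- of the definite part.
  have hcross : ∀ x v : ℝ, |2 * γ * (x * v)| ≤ (2 * E * x ^ 2 + v ^ 2) / 8 := by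
    intro x v
    refine abs_le_of_sq_le_sq ?_ (by positivity)
    nlinarith [sq_nonneg (2 * E * x ^ 2 - v ^ 2), mul_le_mul_of_nonneg_right hγ
      (by positivity : (0 : ℝ) ≤ x ^ 2 * v ^ 2)]
  have hlow : ∀ x v : ℝ, 7 / 8 * (2 * E * x ^ 2 + v ^ 2) ≤
      2 * E * x ^ 2 + v ^ 2 - 2 * γ * (x * v) := fun x v => by
    linarith [(abs_le.1 (hcross x v)).2]
  have hup : ∀ x v : ℝ, 2 * E * x ^ 2 + v ^ 2 - 2 * γ * (x * v) ≤
      9 / 8 * (2 * E * x ^ 2 + v ^ 2) := fun x v => by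
    linarith [(abs_le.1 (hcross x v)).1]
  have hd : 0 < -(σ * γ) := by linarith
  refine ⟨by fun_prop, fun z => le_trans (by positivity) (hlow z.1 z.2), by positivity,
    by positivity, fun k _ => ?_, fun z hz => ⟨_, hasFDerivAt_originEnergy E γ z, ?_⟩⟩
  · have hcl : IsClosed {z : ℝ × ℝ | 2 * E * z.1 ^ 2 + z.2 ^ 2 - 2 * γ * (z.1 * z.2) ≤ k} :=
      isClosed_le (by fun_prop) continuous_const
    refine IsCompact.of_isClosed_subset
      (isCompact_Icc.prod isCompact_Icc : IsCompact
        (Icc (-(1 + k / E)) (1 + k / E) ×ˢ Icc (-(1 + 2 * k)) (1 + 2 * k))) hcl fun z hz => ?_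
    have h1 := (hlow z.1 z.2).trans (show _ ≤ k from hz)
    have h2 : 0 ≤ 2 * E * z.1 ^ 2 := by positivity
    have h3 : z.1 ^ 2 ≤ k / E := by rw [le_div_iff₀ hE]; nlinarith [sq_nonneg z.2]
    have h4 : z.2 ^ 2 ≤ 2 * k := by nlinarith [sq_nonneg z.2]
    refine ⟨abs_le.1 (abs_le_of_sq_le_sq ?_ ?_), abs_le.1 (abs_le_of_sq_le_sq ?_ ?_)⟩ <;>
      nlinarith [sq_nonneg z.1, sq_nonneg z.2]
  · obtain ⟨x, v⟩ := z
    simp only at hz ⊢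
    have hQ : 0 ≤ 2 * E * x ^ 2 + v ^ 2 := by positivity
    have h1 := (hlow x v).trans_lt hz
    set m := min 1 (-(σ * γ) / (8 * (a + b))) with hm
    have hm1 : m ≤ 1 := min_le_left _ _
    have hm2 : (a + b) * m ≤ -(σ * γ) / 8 := by
      have := min_le_right 1 (-(σ * γ) / (8 * (a + b)))
      rw [← hm, le_div_iff₀ (by positivity)] at this
      linarith
    -- The threshold is chosen for this: it bounds `x²` by `m`, hence the nonlinear damping `q` by
    -- `|γ|/8`.
    have hx : x ^ 2 ≤ m := by nlinarith [sq_nonneg v]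
    have hx0 := sq_nonneg x
    set q := a * x ^ 2 - b * x ^ 4 with hq
    have hg : |q| ≤ -(σ * γ) / 8 := by
      have hx4 : x ^ 4 ≤ x ^ 2 := by nlinarith
      have hx4' : 0 ≤ x ^ 4 := by positivity
      rw [abs_le]
      constructor <;> nlinarith
    have hc := hcross x v
    have e1 : (((4 * E * x - 2 * γ * v) • ContinuousLinearMap.fst ℝ ℝ ℝ +
        (2 * v - 2 * γ * x) • ContinuousLinearMap.snd ℝ ℝ ℝ) : ℝ × ℝ →L[ℝ] ℝ)
          (σ • planarField a b E γ (x, v)) = 2 * (σ * γ) * (2 * E * x ^ 2 + v ^ 2)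
            + σ * (4 * q * v ^ 2) - σ * (2 * (γ + q) * (2 * γ * (x * v))) := by
      simp [planarField, hq]; ring
    have hσa : |σ| = 1 := by
      rw [← sq_eq_sq₀ (abs_nonneg _) zero_le_one, sq_abs, hσ, one_pow]
    have hγa : |γ| = -(σ * γ) := by
      rw [← abs_of_neg hσγ, abs_mul, hσa, one_mul]
    have b1 : σ * (4 * q * v ^ 2) ≤ -(σ * γ) / 2 * (2 * E * x ^ 2 + v ^ 2) := by
      refine (le_abs_self _).trans ?_
      rw [abs_mul, hσa, one_mul, abs_mul, abs_mul, abs_of_nonneg (sq_nonneg v),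
        abs_of_nonneg (by norm_num : (0 : ℝ) ≤ 4)]
      nlinarith [mul_le_mul hg (show v ^ 2 ≤ 2 * E * x ^ 2 + v ^ 2 by nlinarith) (sq_nonneg v)
        (by positivity)]
    have b2 : -(σ * (2 * (γ + q) * (2 * γ * (x * v)))) ≤
        -(σ * γ) / 2 * (2 * E * x ^ 2 + v ^ 2) := by
      refine (neg_le_abs _).trans ?_
      rw [abs_mul, hσa, one_mul, abs_mul, abs_mul, abs_of_nonneg (by norm_num : (0 : ℝ) ≤ 2)]
      have h5 : |γ + q| ≤ 9 / 8 * -(σ * γ) := (abs_add_le _ _).trans (by rw [hγa]; linarith)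
      nlinarith [mul_le_mul h5 hc (abs_nonneg _) (by positivity), mul_nonneg hd.le hQ]
    rw [e1]
    nlinarith [mul_le_mul_of_nonneg_left (hup x v) hd.le, mul_nonneg hd.le hQ]

theorem isAsymptoticallyStableSet_zero_of_sign {a b E γ σ : ℝ} (ha : 0 < a) (hb : 0 < b)
    (hE : 0 < E) (hσ : σ ^ 2 = 1) (hσγ : σ * γ < 0) (hγ : γ ^ 2 ≤ E / 32) :
    IsAsymptoticallyStableSet (fun z => σ • planarField a b E γ z) {0} := by
  have h := (isStrictLyapunov_originEnergy ha hb hE hσ hσγ hγ).isAsymptoticallyStableSet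
    ((contDiff_planarField a b E γ).const_smul σ)
  convert h using 1
  ext ⟨x, v⟩
  simp only [mem_singleton_iff, mem_ofPred_eq, Prod.mk_eq_zero]
  constructor
  · rintro ⟨rfl, rfl⟩; simp
  · intro h0
    have h1 : γ * γ ≤ E / 32 := by rw [← sq]; exact hγ
    have h2 : (v - γ * x) ^ 2 + (2 * E - γ ^ 2) * x ^ 2 = 0 := by linear_combination h0
    have h3 : 0 < 2 * E - γ ^ 2 := by linarith
    have hx : x = 0 := by
      by_contra hx
      have : 0 < (2 * E - γ ^ 2) * x ^ 2 := by positivity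
      nlinarith [sq_nonneg (v - γ * x)]
    subst hx
    exact ⟨rfl, by simpa using h0⟩

theorem isAsymptoticallyStableSet_zero {a b E γ : ℝ} (ha : 0 < a) (hb : 0 < b)
    (hE : 0 < E) (hγ : γ < 0) (hγE : γ ^ 2 ≤ E / 32) :
    IsAsymptoticallyStableSet (planarField a b E γ) {0} := by
  simpa using isAsymptoticallyStableSet_zero_of_sign ha hb hE (σ := 1) (by norm_num)
    (by simpa using hγ) hγE

theorem not_isStableSet_zero {a b E γ : ℝ} (ha : 0 < a) (hb : 0 < b)
    (hE : 0 < E) (hγ : 0 < γ) (hγE : γ ^ 2 ≤ E / 32) :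
    ¬ IsStableSet (planarField a b E γ) {0} := by
  have h := isAsymptoticallyStableSet_zero_of_sign ha hb hE (σ := -1) (by norm_num)
    (by simpa using hγ) hγE
  simp only [neg_smul, one_smul] at h
  exact h.2.not_isStableSet_neg (mem_singleton 0) (dense_compl_singleton (0 : ℝ × ℝ) 0)

end Origin

/-! ### Estimates for the scalar polar equation. -/

section PolarEquation

/-- The rescaled damping coefficient at squared radius `y` and polar cosine `c`. -/
def dampingCoeff (k e c y : ℝ) : ℝ := -1 + y * c ^ 2 - k * e * y ^ 2 * c ^ 4

/-- The rescaled angular speed. -/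
def angularSpeed (k e c s y : ℝ) : ℝ := 1 + 2 * e * (s * c) * dampingCoeff k e c y

/-- The right-hand side of the equation `dy/dθ = e G` for the rescaled squared radius `y` as a
function of the angle `θ`, where `c = cos θ` and `s = sin θ`. -/
noncomputable def polarRate (k e c s y : ℝ) : ℝ :=
  4 * y * s ^ 2 * dampingCoeff k e c y / angularSpeed k e c s y

/-- The derivative of `polarRate` in `y`; the terms containing both `angularSpeed` and the
derivative of `dampingCoeff` cancel in the quotient rule, leaving this numerator. -/
noncomputable def polarRateDeriv (k e c s y : ℝ) : ℝ :=
  4 * s ^ 2 * (dampingCoeff k e c y + y * (c ^ 2 - 2 * k * e * y * c ^ 4)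
    + 2 * e * (s * c) * dampingCoeff k e c y ^ 2) / angularSpeed k e c s y ^ 2

theorem abs_dampingCoeff_le {k e c y : ℝ} (hk : 0 ≤ k) (he : 0 ≤ e) (hke : 25 * k * e ≤ 1)
    (hc : |c| ≤ 1) (hy : |y - 4| ≤ 1) : |dampingCoeff k e c y| ≤ 7 := by
  have hc2 : c ^ 2 ≤ 1 := (sq_le_one_iff_abs_le_one c).2 hc
  have hc0 := sq_nonneg c
  have hc4 : c ^ 4 ≤ 1 := by nlinarith
  have hc40 : 0 ≤ c ^ 4 := by positivity
  obtain ⟨h1, h2⟩ := abs_le.1 hy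
  have hy2 : y ^ 2 ≤ 25 := by nlinarith
  have hke0 : 0 ≤ k * e := by positivity
  have h3 : k * e * y ^ 2 * c ^ 4 ≤ 1 := by
    have : k * e * y ^ 2 ≤ 1 := by nlinarith
    have h0 : 0 ≤ k * e * y ^ 2 := by positivity
    nlinarith
  have h4 : 0 ≤ k * e * y ^ 2 * c ^ 4 := by positivity
  have h5 : y * c ^ 2 ≤ 5 := by nlinarith
  have h6 : 0 ≤ y * c ^ 2 := mul_nonneg (by linarith) hc0
  unfold dampingCoeff
  rw [abs_le]; constructor <;> linarith

theorem half_le_angularSpeed {k e c s y : ℝ} (hk : 0 ≤ k) (he : 0 ≤ e) (hke : 25 * k * e ≤ 1)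
    (he1 : 28 * e ≤ 1) (hc : |c| ≤ 1) (hs : |s| ≤ 1) (hy : |y - 4| ≤ 1) :
    1 / 2 ≤ angularSpeed k e c s y := by
  have h1 := abs_dampingCoeff_le hk he hke hc hy
  have h2 : |s * c * dampingCoeff k e c y| ≤ 7 := by
    rw [abs_mul, abs_mul]
    have : |s| * |c| ≤ 1 := mul_le_one₀ hs (abs_nonneg _) hc
    nlinarith [abs_nonneg (dampingCoeff k e c y)]
  have h3 := (abs_le.1 h2).1
  unfold angularSpeed
  nlinarith

theorem abs_polarRate_le {k e c s y : ℝ} (hk : 0 ≤ k) (he : 0 ≤ e) (hke : 25 * k * e ≤ 1)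
    (he1 : 28 * e ≤ 1) (hc : |c| ≤ 1) (hs : |s| ≤ 1) (hy : |y - 4| ≤ 1) :
    |polarRate k e c s y| ≤ 280 := by
  have h1 := abs_dampingCoeff_le hk he hke hc hy
  have h2 := half_le_angularSpeed hk he hke he1 hc hs hy
  have hy' := abs_le.1 hy
  have hs2 : s ^ 2 ≤ 1 := (sq_le_one_iff_abs_le_one s).2 hs
  have h3 : |4 * y * s ^ 2| ≤ 20 := by
    rw [abs_of_nonneg (mul_nonneg (by linarith) (sq_nonneg s))]
    nlinarith [sq_nonneg s]
  unfold polarRate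
  rw [abs_div, abs_of_pos (show 0 < angularSpeed k e c s y by linarith), div_le_iff₀ (by linarith),
    abs_mul]
  nlinarith [mul_le_mul h3 h1 (abs_nonneg _) (by norm_num)]

/-- The rate differs from its value at `e = 0` by an explicit factor `e`; this makes the averaging
error of second order. -/
theorem abs_polarRate_sub_zero_le {k e c s y : ℝ} (hk : 0 ≤ k) (he : 0 ≤ e)
    (hke : 25 * k * e ≤ 1) (he1 : 28 * e ≤ 1) (hc : |c| ≤ 1) (hs : |s| ≤ 1) (hy : |y - 4| ≤ 1) :
    |polarRate k e c s y - 4 * y * s ^ 2 * (-1 + y * c ^ 2)| ≤ 40 * (25 * k + 98) * e := by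
  have h1 := abs_dampingCoeff_le hk he hke hc hy
  have h2 := half_le_angularSpeed hk he hke he1 hc hs hy
  have h0 : |-1 + y * c ^ 2| ≤ 7 := by
    simpa [dampingCoeff] using abs_dampingCoeff_le le_rfl he (by simp) hc hy
  have hy' := abs_le.1 hy
  have hs2 : s ^ 2 ≤ 1 := (sq_le_one_iff_abs_le_one s).2 hs
  have h3 : |4 * y * s ^ 2| ≤ 20 := by
    rw [abs_of_nonneg (mul_nonneg (by linarith) (sq_nonneg s))]
    nlinarith [sq_nonneg s]
  have hD : angularSpeed k e c s y ≠ 0 := by linarith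
  have hc2 : c ^ 2 ≤ 1 := (sq_le_one_iff_abs_le_one c).2 hc
  have hc4 : c ^ 4 ≤ 1 := by nlinarith [sq_nonneg c]
  have hid : polarRate k e c s y - 4 * y * s ^ 2 * (-1 + y * c ^ 2) =
      4 * y * s ^ 2 * (e * (-(k * (y ^ 2 * c ^ 4)) - 2 * (s * c) *
        (dampingCoeff k e c y * (-1 + y * c ^ 2)))) / angularSpeed k e c s y := by
    unfold polarRate
    rw [eq_div_iff hD, sub_mul, div_mul_cancel₀ _ hD]
    unfold angularSpeed dampingCoeff
    ring
  have h4 : |-(k * (y ^ 2 * c ^ 4)) - 2 * (s * c) * (dampingCoeff k e c y * (-1 + y * c ^ 2))|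
      ≤ 25 * k + 98 := by
    refine (abs_sub _ _).trans (add_le_add ?_ ?_)
    · rw [abs_neg, abs_of_nonneg (by positivity)]
      have : y ^ 2 * c ^ 4 ≤ 25 := by
        have : y ^ 2 ≤ 25 := by nlinarith
        nlinarith [sq_nonneg y]
      nlinarith
    · rw [abs_mul, abs_mul, abs_mul, abs_mul, abs_of_pos (by norm_num : (0 : ℝ) < 2)]
      have e1 : |s| * |c| ≤ 1 := mul_le_one₀ hs (abs_nonneg _) hc
      have e2 : |dampingCoeff k e c y| * |-1 + y * c ^ 2| ≤ 49 := by
        nlinarith [mul_le_mul h1 h0 (abs_nonneg _) (by norm_num)]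
      nlinarith [mul_le_mul e1 e2 (by positivity) (by norm_num)]
  rw [hid, abs_div, abs_of_pos (show 0 < angularSpeed k e c s y by linarith),
    div_le_iff₀ (by linarith), abs_mul (4 * y * s ^ 2), abs_mul e,
    abs_of_nonneg he]
  have h5 : 0 ≤ 20 * (e * (25 * k + 98)) := by positivity
  calc _ ≤ 20 * (e * (25 * k + 98)) :=
        mul_le_mul h3 (mul_le_mul_of_nonneg_left h4 he) (by positivity) (by norm_num)
    _ ≤ _ := by nlinarith

theorem hasDerivAt_polarRate {k e c s y : ℝ} (h : angularSpeed k e c s y ≠ 0) :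
    HasDerivAt (polarRate k e c s) (polarRateDeriv k e c s y) y := by
  have h1 : HasDerivAt (dampingCoeff k e c) (c ^ 2 - 2 * k * e * y * c ^ 4) y := by
    have h2 := (((hasDerivAt_id y).mul_const (c ^ 2)).const_add (-1)).sub
      (((hasDerivAt_pow 2 y).const_mul (k * e)).mul_const (c ^ 4))
    convert! h2 using 1
    simp only [Nat.cast_ofNat, Nat.add_one_sub_one, pow_one]; ring
  have h3 : HasDerivAt (angularSpeed k e c s)
      (2 * e * (s * c) * (c ^ 2 - 2 * k * e * y * c ^ 4)) y :=
    (h1.const_mul (2 * e * (s * c))).const_add 1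
  have h4 := ((((hasDerivAt_id y).const_mul 4).mul_const (s ^ 2)).mul h1).div h3 h
  convert! h4 using 1
  unfold polarRateDeriv
  congr 1
  simp only [angularSpeed, id, Pi.mul_apply]
  ring

theorem polarRateDeriv_zero (k c s : ℝ) :
    polarRateDeriv k 0 c s 4 = 4 * s ^ 2 * (8 * c ^ 2 - 1) := by
  simp only [polarRateDeriv, dampingCoeff, angularSpeed, mul_zero, zero_mul, add_zero, sub_zero,
    one_pow, div_one]
  ring

/-- Continuity at `e = 0`, `y = 4` is made uniform in `(c, s)` by compactness of the square. The
tolerance 1 is half of the mean 2 of the limiting derivative, so expansion survives. -/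
theorem exists_abs_polarRateDeriv_sub_le (k : ℝ) : ∃ r > 0, ∀ e y, |e| ≤ r → |y - 4| ≤ r →
    ∀ c s, |c| ≤ 1 → |s| ≤ 1 →
      |polarRateDeriv k e c s y - 4 * s ^ 2 * (8 * c ^ 2 - 1)| ≤ 1 := by
  have hev : ∀ᶠ x : ℝ × ℝ in 𝓝 (0, 4), ∀ p ∈ Icc (-1 : ℝ) 1 ×ˢ Icc (-1 : ℝ) 1,
      |polarRateDeriv k x.1 p.1 p.2 x.2 - 4 * p.2 ^ 2 * (8 * p.1 ^ 2 - 1)| < 1 := by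
    refine (isCompact_Icc.prod isCompact_Icc).eventually_forall_of_forall_eventually
      fun p _ => ?_
    have hcont : ContinuousAt (fun z : (ℝ × ℝ) × (ℝ × ℝ) =>
        |polarRateDeriv k z.1.1 z.2.1 z.2.2 z.1.2 - 4 * z.2.2 ^ 2 * (8 * z.2.1 ^ 2 - 1)|)
        ((0, 4), p) := by
      refine ContinuousAt.abs (ContinuousAt.sub ?_ (by fun_prop))
      unfold polarRateDeriv
      refine ContinuousAt.div ?_ ?_ (by simp [angularSpeed])
      · unfold dampingCoeff; fun_prop
      · unfold angularSpeed dampingCoeff; fun_prop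
    refine hcont.eventually_lt continuousAt_const ?_
    simp [polarRateDeriv_zero]
  obtain ⟨r, hr, hball⟩ := Metric.nhds_basis_closedBall.eventually_iff.1 hev
  refine ⟨r, hr, fun e y he hy c s hc hs => ?_⟩
  refine (hball (x := (e, y)) ?_ (c, s) ⟨abs_le.1 hc, abs_le.1 hs⟩).le
  rw [Metric.mem_closedBall, Prod.dist_eq, max_le_iff, Real.dist_eq, Real.dist_eq]
  simpa using ⟨he, hy⟩

/-- Mean value inequality for the rate minus its limiting linear part. -/
theorem abs_polarRate_sub_sub_le {k e c s η : ℝ}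
    (hD : ∀ y, |y - 4| ≤ η → 1 / 2 ≤ angularSpeed k e c s y)
    (hd : ∀ y, |y - 4| ≤ η → |polarRateDeriv k e c s y - 4 * s ^ 2 * (8 * c ^ 2 - 1)| ≤ 1)
    {y₁ y₂ : ℝ} (h₁ : |y₁ - 4| ≤ η) (h₂ : |y₂ - 4| ≤ η) :
    |polarRate k e c s y₁ - polarRate k e c s y₂ - 4 * s ^ 2 * (8 * c ^ 2 - 1) * (y₁ - y₂)|
      ≤ |y₁ - y₂| := by
  have hder : ∀ y ∈ Metric.closedBall (4 : ℝ) η, HasDerivWithinAt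
      (fun y => polarRate k e c s y - 4 * s ^ 2 * (8 * c ^ 2 - 1) * y)
      (polarRateDeriv k e c s y - 4 * s ^ 2 * (8 * c ^ 2 - 1)) (Metric.closedBall (4 : ℝ) η) y := by
    intro y hy
    rw [Metric.mem_closedBall, Real.dist_eq] at hy
    have h1 := hasDerivAt_polarRate (show angularSpeed k e c s y ≠ 0 by linarith [hD y hy])
    have h2 := h1.sub ((hasDerivAt_id y).const_mul (4 * s ^ 2 * (8 * c ^ 2 - 1)))
    rw [mul_one] at h2
    exact h2.hasDerivWithinAt
  have h := (convex_closedBall (4 : ℝ) η).norm_image_sub_le_of_norm_hasDerivWithin_le hder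
    (C := 1) (fun y hy => hd y (by simpa [Real.dist_eq] using hy))
    (x := y₂) (y := y₁) (by simpa [Real.dist_eq] using h₂) (by simpa [Real.dist_eq] using h₁)
  rw [Real.norm_eq_abs, Real.norm_eq_abs, one_mul] at h
  refine le_trans (le_of_eq ?_) h
  congr 1; ring

/-- The symmetry of the system under `(ψ, v) ↦ (-ψ, -v)`. It makes the polar equation `π`-periodic,
so half a turn suffices and both turning points have the same `|ψ|`. -/
theorem polarRate_neg_neg (k e c s y : ℝ) : polarRate k e (-c) (-s) y = polarRate k e c s y := by
  simp [polarRate, dampingCoeff, angularSpeed, even_two.neg_pow,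
    (by decide : Even 4).neg_pow]

theorem continuous_polarRate_cos_sin {k e y : ℝ}
    (hD : ∀ c s, |c| ≤ 1 → |s| ≤ 1 → 1 / 2 ≤ angularSpeed k e c s y) :
    Continuous fun t => polarRate k e (Real.cos t) (Real.sin t) y := by
  unfold polarRate
  refine Continuous.div (by unfold dampingCoeff; fun_prop)
    (by unfold angularSpeed dampingCoeff; fun_prop) fun t => ?_
  linarith [hD _ _ (Real.abs_cos_le_one t) (Real.abs_sin_le_one t)]

end PolarEquation

/-! ### Averaging and the periodic solution of the polar equation. -/

section PeriodicSolution

theorem continuous_of_lipschitz_flow {F : ℝ → ℝ → ℝ} {K : NNReal}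
    (hK : ∀ t, LipschitzWith K (F t)) {Y : ℝ → ℝ → ℝ} (hY0 : ∀ y, Y y 0 = y)
    (hY : ∀ y, IsIntegralCurve (Y y) F) {T : ℝ} (hT : 0 ≤ T) : Continuous fun y => Y y T := by
  refine (LipschitzWith.of_dist_le_mul (K := (Real.exp (K * T)).toNNReal) fun y z => ?_).continuous
  have h := dist_le_of_trajectories_ODE (v := F) (K := K) (δ := dist y z) (a := 0) (b := T)
    (f := Y y) (g := Y z)
    (fun t => hK t) (hY y).continuous.continuousOn (fun t _ => (hY y t).hasDerivWithinAt)
    (hY z).continuous.continuousOn (fun t _ => (hY z t).hasDerivWithinAt)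
    (by rw [hY0, hY0]) T ⟨hT, le_rfl⟩
  rw [Real.coe_toNNReal _ (Real.exp_pos _).le, mul_comm]
  simpa using h

theorem periodic_of_isIntegralCurve {F : ℝ → ℝ → ℝ} {K : NNReal}
    (hK : ∀ t, LipschitzWith K (F t)) {T : ℝ} (hF : Function.Periodic F T) {c : ℝ → ℝ}
    (hc : IsIntegralCurve c F) (h0 : c T = c 0) : Function.Periodic c T := by
  have heq : (fun t => c (t + T)) = c :=
    ODE_solution_unique_univ (t₀ := 0) (v := F) (s := fun _ => univ)
      (fun t => (hK t).lipschitzOnWith)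
      (fun t => ⟨by simpa only [hF t] using (hc (t + T)).comp_add_const t T, mem_univ _⟩)
      (fun t => ⟨hc t, mem_univ _⟩) (by simpa using h0)
  exact fun t => congrFun heq t

/-- An explicit primitive of the rate at `e = 0` with `y` frozen at `y₀`; its increment over `[0,
π]` is the average `(π/2) y₀ (y₀ - 4)`. -/
theorem hasDerivAt_averagedPrimitive (y₀ t : ℝ) :
    HasDerivAt (fun t => 4 * y₀ * (y₀ * (t / 8 - Real.sin (4 * t) / 32) -
      (t / 2 - Real.sin (2 * t) / 4)))
      (4 * y₀ * Real.sin t ^ 2 * (-1 + y₀ * Real.cos t ^ 2)) t := by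
  have h4 : HasDerivAt (fun t => Real.sin (4 * t)) (Real.cos (4 * t) * 4) t := by
    simpa using ((hasDerivAt_id t).const_mul 4).sin
  have h2 : HasDerivAt (fun t => Real.sin (2 * t)) (Real.cos (2 * t) * 2) t := by
    simpa using ((hasDerivAt_id t).const_mul 2).sin
  have h := ((((hasDerivAt_id t).div_const 8).sub (h4.div_const 32)).const_mul y₀).sub
    (((hasDerivAt_id t).div_const 2).sub (h2.div_const 4)) |>.const_mul (4 * y₀)
  convert! h using 1
  have e2 : Real.cos (2 * t) = 2 * Real.cos t ^ 2 - 1 := Real.cos_two_mul t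
  have e4 : Real.cos (4 * t) = 2 * Real.cos (2 * t) ^ 2 - 1 := by
    rw [← Real.cos_two_mul]; ring_nf
  rw [e4, e2, Real.sin_sq]
  ring

/-- Over half a revolution the squared radius changes by its first-order average, up to an error of
second order. -/
theorem abs_halfTurn_sub_le {k e η : ℝ} (hk : 0 ≤ k) (he : 0 ≤ e) (hke : 25 * k * e ≤ 1)
    (he1 : 28 * e ≤ 1) (hη1 : η ≤ 1) (heη : 280 * e * Real.pi ≤ η / 4)
    (hlip : ∀ c s, |c| ≤ 1 → |s| ≤ 1 → ∀ y₁ y₂, |y₁ - 4| ≤ η → |y₂ - 4| ≤ η →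
      |polarRate k e c s y₁ - polarRate k e c s y₂| ≤ 29 * |y₁ - y₂|)
    {y₀ : ℝ} (hy₀ : |y₀ - 4| ≤ η / 4) {Y : ℝ → ℝ} (hY0 : Y 0 = y₀)
    (hY : ∀ t, ∃ y, |y - 4| ≤ η ∧ (|Y t - 4| ≤ η → y = Y t) ∧
      HasDerivAt Y (e * polarRate k e (Real.cos t) (Real.sin t) y) t) :
    (∀ t ∈ Icc 0 Real.pi, |Y t - 4| ≤ η / 2) ∧
    |Y Real.pi - y₀ - e * (Real.pi / 2 * y₀ * (y₀ - 4))| ≤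
      (40 * (25 * k + 98) + 29 * 280 * Real.pi) * Real.pi * e ^ 2 := by
  have hη : 0 ≤ η := by linarith [abs_nonneg (y₀ - 4)]
  choose y hyη hyY hder using hY
  have hpi := Real.pi_pos
  have hG : ∀ t z, |z - 4| ≤ η → |polarRate k e (Real.cos t) (Real.sin t) z| ≤ 280 := fun t z hz =>
    abs_polarRate_le hk he hke he1 (Real.abs_cos_le_one t) (Real.abs_sin_le_one t) (hz.trans hη1)
  have hnear : ∀ t ∈ Icc 0 Real.pi, |Y t - y₀| ≤ 280 * e * Real.pi := by
    intro t ht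
    have h := norm_image_sub_le_of_norm_deriv_le_segment' (f := Y) (a := 0) (b := Real.pi)
      (C := 280 * e) (fun t _ => (hder t).hasDerivWithinAt) (fun t _ => by
        rw [Real.norm_eq_abs, abs_mul, abs_of_nonneg he, mul_comm]
        exact mul_le_mul_of_nonneg_right (hG t _ (hyη t)) he) t ht
    rw [hY0, Real.norm_eq_abs, sub_zero] at h
    exact h.trans (mul_le_mul_of_nonneg_left ht.2 (by positivity))
  have hstay : ∀ t ∈ Icc 0 Real.pi, |Y t - 4| ≤ η / 2 := by
    intro t ht
    have h1 := abs_le.1 (hnear t ht)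
    have h2 := abs_le.1 hy₀
    rw [abs_le]; constructor <;> linarith
  refine ⟨hstay, ?_⟩
  -- The first summand comes from setting `e = 0` in the rate, the second from replacing `Y t` by
  -- `y₀`: the Lipschitz constant 29 times the drift `280 e π`.
  set M := 40 * (25 * k + 98) + 29 * 280 * Real.pi
  let p : ℝ → ℝ := fun t => 4 * y₀ * (y₀ * (t / 8 - Real.sin (4 * t) / 32) -
      (t / 2 - Real.sin (2 * t) / 4))
  have h := norm_image_sub_le_of_norm_deriv_le_segment' (f := fun t => Y t - e * p t) (a := 0)
    (b := Real.pi) (C := M * e ^ 2)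
    (fun t _ => ((hder t).sub ((hasDerivAt_averagedPrimitive y₀ t).const_mul e)).hasDerivWithinAt)
    (fun t ht => ?_) Real.pi ⟨hpi.le, le_rfl⟩
  · have hp0 : p 0 = 0 := by simp [p]
    have hppi : p Real.pi = Real.pi / 2 * y₀ * (y₀ - 4) := by
      have e1 : Real.sin (4 * Real.pi) = 0 := by
        simpa using Real.sin_nat_mul_pi 4
      simp only [p, e1, Real.sin_two_pi]; ring
    simp only [hp0, hppi, hY0, Real.norm_eq_abs, sub_zero, mul_zero] at h
    calc _ = |Y Real.pi - e * (Real.pi / 2 * y₀ * (y₀ - 4)) - y₀| := by congr 1; ring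
      _ ≤ _ := h
      _ = _ := by ring
  · have ht' := Ico_subset_Icc_self ht
    have hc := Real.abs_cos_le_one t
    have hs := Real.abs_sin_le_one t
    have hYt : |Y t - 4| ≤ η := (hstay t ht').trans (by linarith)
    rw [hyY t hYt, Real.norm_eq_abs, ← mul_sub, abs_mul, abs_of_nonneg he]
    have h1 := hlip _ _ hc hs (Y t) y₀ hYt (hy₀.trans (by linarith))
    have h2 := abs_polarRate_sub_zero_le hk he hke he1 hc hs
      (show |y₀ - 4| ≤ 1 by linarith)
    have h3 := hnear t ht'
    have h4 := abs_sub_le (polarRate k e (Real.cos t) (Real.sin t) (Y t))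
      (polarRate k e (Real.cos t) (Real.sin t) y₀)
      (4 * y₀ * Real.sin t ^ 2 * (-1 + y₀ * Real.cos t ^ 2))
    calc _ ≤ e * (M * e) := by
          refine mul_le_mul_of_nonneg_left (h4.trans ?_) he
          simp only [M]
          nlinarith
      _ = _ := by ring

/-- For small `e > 0` the polar equation has a `π`-periodic solution close to the zero `4` of the
averaged equation, near which it is uniformly expanding. -/
theorem exists_periodic_polar_solution {k : ℝ} (hk : 0 ≤ k) :
    ∃ e₀ > 0, ∃ η > 0, ∃ C : ℝ, η ≤ 1 ∧ ∀ e, 0 < e → e < e₀ →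
      (e ≤ 1 ∧ ∀ c s y, |c| ≤ 1 → |s| ≤ 1 → |y - 4| ≤ η → 1 / 2 ≤ angularSpeed k e c s y) ∧
      (∀ c s, |c| ≤ 1 → |s| ≤ 1 → ∀ y₁ y₂, |y₁ - 4| ≤ η → |y₂ - 4| ≤ η →
        |polarRate k e c s y₁ - polarRate k e c s y₂ - 4 * s ^ 2 * (8 * c ^ 2 - 1) * (y₁ - y₂)|
          ≤ |y₁ - y₂|) ∧
      ∃ Y : ℝ → ℝ, Function.Periodic Y Real.pi ∧
        (∀ t, HasDerivAt Y (e * polarRate k e (Real.cos t) (Real.sin t) (Y t)) t) ∧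
        (∀ t, |Y t - 4| ≤ η / 2) ∧ |Y 0 - 4| ≤ C * e := by
  have hpi := Real.pi_pos
  have hpi3 := Real.pi_gt_three
  obtain ⟨r, hr, hder⟩ := exists_abs_polarRateDeriv_sub_le k
  set η := min r 1 with hη_def
  have hη : 0 < η := lt_min hr one_pos
  have hη1 : η ≤ 1 := min_le_right _ _
  set C := (40 * (25 * k + 98) + 29 * 280 * Real.pi) * Real.pi with hC_def
  have hC : 0 < C := by positivity
  have hsmall : ∀ᶠ e : ℝ in 𝓝 0, 25 * k * e < 1 ∧ 28 * e < 1 ∧ 280 * e * Real.pi < η / 4 ∧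
      C * e < η / 4 ∧ e < r := by
    refine (ContinuousAt.eventually_lt (by fun_prop) continuousAt_const (by simp)).and
      ((ContinuousAt.eventually_lt (by fun_prop) continuousAt_const (by simp)).and
      ((ContinuousAt.eventually_lt (by fun_prop) continuousAt_const (by simpa)).and
      ((ContinuousAt.eventually_lt (by fun_prop) continuousAt_const (by simpa)).and
      (gt_mem_nhds hr))))
  obtain ⟨e₀, he₀, hball⟩ := Metric.eventually_nhds_iff.1 hsmall
  refine ⟨e₀, he₀, η, hη, C, hη1, fun e he hee₀ => ?_⟩
  obtain ⟨hke, he1, heη, hCe, her⟩ := hball (y := e) (by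
    rw [Real.dist_eq, sub_zero, abs_of_pos he]; exact hee₀)
  have hD : ∀ c s y, |c| ≤ 1 → |s| ≤ 1 → |y - 4| ≤ η → 1 / 2 ≤ angularSpeed k e c s y :=
    fun c s y hc hs hy => half_le_angularSpeed hk he.le hke.le he1.le hc hs (hy.trans hη1)
  have hexp : ∀ c s, |c| ≤ 1 → |s| ≤ 1 → ∀ y₁ y₂, |y₁ - 4| ≤ η → |y₂ - 4| ≤ η →
        |polarRate k e c s y₁ - polarRate k e c s y₂ - 4 * s ^ 2 * (8 * c ^ 2 - 1) * (y₁ - y₂)|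
          ≤ |y₁ - y₂| := fun c s hc hs y₁ y₂ h₁ h₂ =>
    abs_polarRate_sub_sub_le (fun y hy => hD c s y hc hs hy)
      (fun y hy => hder e y (by rw [abs_of_pos he]; exact her.le) (hy.trans (min_le_left _ _))
        c s hc hs) h₁ h₂
  have hlip : ∀ c s, |c| ≤ 1 → |s| ≤ 1 → ∀ y₁ y₂, |y₁ - 4| ≤ η → |y₂ - 4| ≤ η →
      |polarRate k e c s y₁ - polarRate k e c s y₂| ≤ 29 * |y₁ - y₂| := by
    intro c s hc hs y₁ y₂ h₁ h₂
    have h := hexp c s hc hs y₁ y₂ h₁ h₂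
    have hc2 : c ^ 2 ≤ 1 := (sq_le_one_iff_abs_le_one c).2 hc
    have hs2 : s ^ 2 ≤ 1 := (sq_le_one_iff_abs_le_one s).2 hs
    have hb : |4 * s ^ 2 * (8 * c ^ 2 - 1)| ≤ 28 := by
      have := sq_nonneg c
      have := sq_nonneg s
      rw [abs_le]; constructor <;> nlinarith
    have h3 := abs_add_le (polarRate k e c s y₁ - polarRate k e c s y₂ -
      4 * s ^ 2 * (8 * c ^ 2 - 1) * (y₁ - y₂)) (4 * s ^ 2 * (8 * c ^ 2 - 1) * (y₁ - y₂))
    rw [sub_add_cancel, abs_mul (4 * s ^ 2 * (8 * c ^ 2 - 1))] at h3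
    nlinarith [abs_nonneg (y₁ - y₂)]
  refine ⟨⟨by linarith, hD⟩, hexp, ?_⟩
  have hle : 4 - η ≤ 4 + η := by linarith
  -- Projecting `y` onto the band gives a globally Lipschitz, bounded equation. The periodic
  -- solution found below stays in the band, where nothing was changed.
  let pr : ℝ → ℝ := fun y => projIcc (4 - η) (4 + η) hle y
  have hpr : ∀ y, |pr y - 4| ≤ η := fun y => by
    have h := (projIcc (4 - η) (4 + η) hle y).2
    rw [abs_le]; constructor <;> linarith [h.1, h.2]
  have hpr' : ∀ y, |y - 4| ≤ η → pr y = y := fun y hy => by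
    have h := abs_le.1 hy
    simp only [pr]
    rw [projIcc_of_mem hle ⟨by linarith, by linarith⟩]
  let F : ℝ → ℝ → ℝ := fun t y => e * polarRate k e (Real.cos t) (Real.sin t) (pr y)
  have hF : ∀ t, LipschitzWith (e * 29).toNNReal (F t) := fun t =>
    LipschitzWith.of_dist_le_mul fun y z => by
      have h1 := hlip _ _ (Real.abs_cos_le_one t) (Real.abs_sin_le_one t) _ _ (hpr y) (hpr z)
      have h2 : |pr y - pr z| ≤ |y - z| := by
        simpa [Real.dist_eq, Subtype.dist_eq] using (LipschitzWith.projIcc hle).dist_le_mul y z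
      rw [Real.coe_toNNReal _ (by positivity), Real.dist_eq, Real.dist_eq, ← mul_sub, abs_mul,
        abs_of_pos he, mul_assoc]
      exact mul_le_mul_of_nonneg_left (h1.trans (by linarith)) he.le
  have hFper : Function.Periodic F Real.pi := fun t => by
    funext y
    simp only [F, Real.cos_add_pi, Real.sin_add_pi, polarRate_neg_neg]
  have hFcont : ∀ y, Continuous fun t => F t y := fun y =>
    (continuous_polarRate_cos_sin fun c s hc hs => hD c s _ hc hs (hpr y)).const_mul e
  have hFbd : ∀ t y, ‖F t y‖ ≤ ((e * 280).toNNReal : ℝ) := fun t y => by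
    rw [Real.coe_toNNReal _ (by positivity), Real.norm_eq_abs, abs_mul, abs_of_pos he]
    exact mul_le_mul_of_nonneg_left (abs_polarRate_le hk he.le hke.le he1.le
      (Real.abs_cos_le_one t) (Real.abs_sin_le_one t) ((hpr y).trans hη1)) he.le
  choose Y hY0 hY using exists_isIntegralCurve_of_lipschitz_of_bounded hF hFcont hFbd
  have hhalf : ∀ y₀, |y₀ - 4| ≤ C * e → (∀ t ∈ Icc 0 Real.pi, |Y y₀ t - 4| ≤ η / 2) ∧
      |Y y₀ Real.pi - y₀ - e * (Real.pi / 2 * y₀ * (y₀ - 4))| ≤ C * e ^ 2 := fun y₀ hy₀ =>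
    abs_halfTurn_sub_le hk he.le hke.le he1.le hη1 heη.le hlip (hy₀.trans hCe.le) (hY0 y₀)
      (fun t => ⟨pr (Y y₀ t), hpr _, fun h => hpr' _ h, hY y₀ t⟩)
  have hCe0 : 0 < C * e := by positivity
  have hcontP : Continuous fun y => Y y Real.pi - y :=
    (continuous_of_lipschitz_flow hF hY0 hY hpi.le).sub continuous_id
  -- Here the averaged displacement has modulus `(π/2) y₀ C e²`, which dominates the error `C e²`
  -- because `(π/2) y₀ ≥ 1`.
  have hlow : Y (4 - C * e) Real.pi - (4 - C * e) ≤ 0 := by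
    have h := (abs_le.1 (hhalf (4 - C * e) (by simp [abs_of_pos hC, abs_of_pos he])).2).2
    have h1 : 1 ≤ Real.pi / 2 * (4 - C * e) := by nlinarith
    have h2 : C * e ^ 2 ≤ Real.pi / 2 * (4 - C * e) * (C * e ^ 2) := by
      nlinarith [mul_pos hC (pow_pos he 2)]
    linarith
  have hhigh : 0 ≤ Y (4 + C * e) Real.pi - (4 + C * e) := by
    have h := (abs_le.1 (hhalf (4 + C * e) (by simp [abs_of_pos hC, abs_of_pos he])).2).1
    have h1 : 1 ≤ Real.pi / 2 * (4 + C * e) := by nlinarith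
    have h2 : C * e ^ 2 ≤ Real.pi / 2 * (4 + C * e) * (C * e ^ 2) := by
      nlinarith [mul_pos hC (pow_pos he 2)]
    linarith
  obtain ⟨y₀, hy₀, hfix⟩ := intermediate_value_Icc (show 4 - C * e ≤ 4 + C * e by linarith)
    hcontP.continuousOn ⟨hlow, hhigh⟩
  have hy₀' : |y₀ - 4| ≤ C * e := by
    rw [abs_le]; constructor <;> linarith [hy₀.1, hy₀.2]
  have hper : Function.Periodic (Y y₀) Real.pi :=
    periodic_of_isIntegralCurve hF hFper (hY y₀) (by rw [hY0]; simpa [sub_eq_zero] using hfix)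
  have hstay : ∀ t, |Y y₀ t - 4| ≤ η / 2 := fun t => by
    obtain ⟨s, hs, hts⟩ := hper.exists_mem_Ico₀ hpi t
    rw [hts]
    exact (hhalf y₀ hy₀').1 s (Ico_subset_Icc_self hs)
  refine ⟨Y y₀, hper, fun t => ?_, hstay, by rw [hY0]; exact hy₀'⟩
  have h := hY y₀ t
  simp only [F] at h
  rwa [hpr' _ ((hstay t).trans (by linarith))] at h

end PeriodicSolution

/-! ### The polar angle and its differential. -/

section PolarAngle

/-- The complex number whose argument is the clockwise polar angle of `(x, v / ω)`. -/
noncomputable def phasePoint (ω : ℝ) (z : ℝ × ℝ) : ℂ := ⟨z.1, -(z.2 / ω)⟩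

noncomputable def phaseAngle (ω : ℝ) (z : ℝ × ℝ) : ℝ := (phasePoint ω z).arg

/-- The squared radius of `(x, v / ω)`. -/
noncomputable def phaseSq (ω : ℝ) (z : ℝ × ℝ) : ℝ := z.1 ^ 2 + (z.2 / ω) ^ 2

noncomputable def phaseAngleForm (ω : ℝ) (z : ℝ × ℝ) : ℝ × ℝ →L[ℝ] ℝ :=
  (ω * phaseSq ω z)⁻¹ • (z.2 • ContinuousLinearMap.fst ℝ ℝ ℝ - z.1 • ContinuousLinearMap.snd ℝ ℝ ℝ)

theorem normSq_phasePoint (ω : ℝ) (z : ℝ × ℝ) : Complex.normSq (phasePoint ω z) = phaseSq ω z := by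
  simp [phasePoint, phaseSq, Complex.normSq_apply]; ring

theorem phasePoint_ne_zero {ω : ℝ} {z : ℝ × ℝ} (hz : 0 < phaseSq ω z) : phasePoint ω z ≠ 0 := by
  rw [← Complex.normSq_pos, normSq_phasePoint]; exact hz

theorem phaseSq_pos {ω : ℝ} (hω : 0 < ω) {z : ℝ × ℝ} (hz : z ≠ 0) : 0 < phaseSq ω z := by
  rw [← normSq_phasePoint, Complex.normSq_pos]
  intro h
  apply hz
  have h1 := congrArg Complex.re h
  have h2 := congrArg Complex.im h
  simp [phasePoint] at h1 h2
  exact Prod.ext h1 (by simpa [hω.ne'] using h2)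

theorem continuous_phaseSq (ω : ℝ) : Continuous (phaseSq ω) := by
  unfold phaseSq; fun_prop

theorem eq_polar (ω : ℝ) (hω : 0 < ω) (z : ℝ × ℝ) :
    z.1 = Real.sqrt (phaseSq ω z) * Real.cos (phaseAngle ω z) ∧
    z.2 = -(ω * Real.sqrt (phaseSq ω z) * Real.sin (phaseAngle ω z)) := by
  have hn : ‖phasePoint ω z‖ = Real.sqrt (phaseSq ω z) := by
    rw [← normSq_phasePoint]; rfl
  have h1 := Complex.norm_mul_cos_arg (phasePoint ω z)
  have h2 := Complex.norm_mul_sin_arg (phasePoint ω z)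
  rw [hn] at h1 h2
  refine ⟨h1.symm, ?_⟩
  have h3 : (phasePoint ω z).im = -(z.2 / ω) := rfl
  have h4 : ω * (Real.sqrt (phaseSq ω z) * Real.sin (phaseAngle ω z)) = ω * -(z.2 / ω) := by
    rw [← h3, ← h2]; rfl
  rw [mul_assoc, h4]; field_simp

/-- Periodic functions see the angle only modulo `2π`, so the jump of `Complex.arg` does no harm. -/
theorem Function.Periodic.eq_of_coe_angle_eq {p : ℝ → ℝ} (hp : Function.Periodic p (2 * Real.pi))
    {θ ψ : ℝ} (h : (θ : Real.Angle) = ψ) : p θ = p ψ := by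
  obtain ⟨n, hn⟩ := Real.Angle.angle_eq_iff_two_pi_dvd_sub.1 h
  have : θ = ψ + n * (2 * Real.pi) := by linarith
  rw [this]; exact hp.int_mul n ψ

theorem apply_phaseAngle_polar {p : ℝ → ℝ} (hp : Function.Periodic p (2 * Real.pi)) {ω r : ℝ}
    (hω : 0 < ω) (hr : 0 < r) (θ : ℝ) :
    p (phaseAngle ω (r * Real.cos θ, -(ω * r * Real.sin θ))) = p θ := by
  apply hp.eq_of_coe_angle_eq
  have : phasePoint ω (r * Real.cos θ, -(ω * r * Real.sin θ)) =
      r * (Real.cos (θ : Real.Angle).toReal + Real.sin (θ : Real.Angle).toReal * Complex.I) := by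
    have e1 : Real.cos (θ : Real.Angle).toReal = Real.cos θ := by
      rw [Real.Angle.cos_toReal, Real.Angle.cos_coe]
    have e2 : Real.sin (θ : Real.Angle).toReal = Real.sin θ := by
      rw [Real.Angle.sin_toReal, Real.Angle.sin_coe]
    rw [e1, e2]
    apply Complex.ext
    · simp only [phasePoint, Complex.mul_re, Complex.ofReal_re, Complex.ofReal_im, Complex.add_re,
        Complex.mul_im, Complex.add_im, Complex.I_re, Complex.I_im]
      ring
    · simp only [phasePoint, Complex.mul_im, Complex.ofReal_re, Complex.ofReal_im, Complex.add_im,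
        Complex.mul_re, Complex.add_re, Complex.I_re, Complex.I_im]
      field_simp; ring
  unfold phaseAngle
  rw [this]
  have h := Complex.arg_mul_cos_add_sin_mul_I_coe_angle hr (θ : Real.Angle)
  simpa using h

theorem phaseSq_polar {ω : ℝ} (hω : 0 < ω) (r θ : ℝ) :
    phaseSq ω (r * Real.cos θ, -(ω * r * Real.sin θ)) = r ^ 2 := by
  have : -(ω * r * Real.sin θ) / ω = -(r * Real.sin θ) := by field_simp
  simp only [phaseSq, this]
  linear_combination r ^ 2 * Real.sin_sq_add_cos_sq θ

theorem hasFDerivAt_phasePoint (ω : ℝ) (z : ℝ × ℝ) : HasFDerivAt (phasePoint ω)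
    (Complex.ofRealCLM.comp (ContinuousLinearMap.fst ℝ ℝ ℝ) -
      ((ω⁻¹ : ℝ) * Complex.I : ℂ) • Complex.ofRealCLM.comp (ContinuousLinearMap.snd ℝ ℝ ℝ)) z := by
  have h : phasePoint ω = ⇑(Complex.ofRealCLM.comp (ContinuousLinearMap.fst ℝ ℝ ℝ) -
      ((ω⁻¹ : ℝ) * Complex.I : ℂ) • Complex.ofRealCLM.comp (ContinuousLinearMap.snd ℝ ℝ ℝ)) := by
    funext w
    apply Complex.ext <;> simp [phasePoint, div_eq_inv_mul, -Complex.ofReal_inv]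
  rw [h]
  exact ContinuousLinearMap.hasFDerivAt _

theorem hasFDerivAt_comp_phaseAngle {p : ℝ → ℝ} (hp : Function.Periodic p (2 * Real.pi)) {ω : ℝ}
    {z : ℝ × ℝ} (hz : 0 < phaseSq ω z) {p' : ℝ} (hd : HasDerivAt p p' (phaseAngle ω z)) :
    HasFDerivAt (fun w => p (phaseAngle ω w)) (p' • phaseAngleForm ω z) z := by
  have hz0 := phasePoint_ne_zero hz
  -- Modulo `2π` the angle at `w` is that at `z` plus `Im log (w/z)`, and near `w = z` the logarithm
  -- is evaluated near 1, away from its cut.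
  have hev : (fun w => p (phaseAngle ω w)) =ᶠ[𝓝 z] fun w =>
      p (phaseAngle ω z + (Complex.log (phasePoint ω w / phasePoint ω z)).im) := by
    filter_upwards [(isOpen_lt continuous_const (continuous_phaseSq ω)).mem_nhds hz] with w hw
    apply hp.eq_of_coe_angle_eq
    rw [Complex.log_im, Real.Angle.coe_add, Complex.arg_div_coe_angle (phasePoint_ne_zero hw) hz0]
    simp [phaseAngle]
  refine HasFDerivAt.congr_of_eventuallyEq ?_ hev
  have h1 := (hasFDerivAt_phasePoint ω z).mul_const (phasePoint ω z)⁻¹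
  have hlog : HasFDerivAt Complex.log
      ((ContinuousLinearMap.toSpanSingleton ℂ (1 : ℂ)).restrictScalars ℝ)
      (phasePoint ω z * (phasePoint ω z)⁻¹) := by
    rw [mul_inv_cancel₀ hz0]
    have := (Complex.hasStrictDerivAt_log Complex.one_mem_slitPlane).hasDerivAt.hasFDerivAt
    simpa using this.restrictScalars ℝ
  have h2 := (Complex.imCLM.hasFDerivAt.comp z (hlog.comp z h1)).const_add (phaseAngle ω z)
  have hd' : HasDerivAt p p' (phaseAngle ω z +
      Complex.imCLM (Complex.log (phasePoint ω z * (phasePoint ω z)⁻¹))) := by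
    simpa [mul_inv_cancel₀ hz0] using hd
  have h3 := hd'.comp_hasFDerivAt z h2
  simp only [div_eq_mul_inv]
  refine h3.congr_fderiv ?_
  congr 1
  have e1 : (phasePoint ω z)⁻¹.re = z.1 / phaseSq ω z := by
    rw [Complex.inv_re, normSq_phasePoint]; rfl
  have e2 : (phasePoint ω z)⁻¹.im = z.2 / ω / phaseSq ω z := by
    rw [Complex.inv_im, normSq_phasePoint]; simp [phasePoint]
  ext
  · simp [phaseAngleForm, e2]; ring
  · simp [phaseAngleForm, e1]; ring

end PolarAngle

/-! ### The Lyapunov function of the cycle. -/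

section Cycle

/-- A `π`-periodic solution `Y` of the polar equation for the parameter `γ = -(ω e)`, together with
the estimates that make it expanding on the band `|y - 4| ≤ η`. -/
structure IsPolarCycle (a b E ω e η : ℝ) (Y : ℝ → ℝ) : Prop where
  a_pos : 0 < a
  ω_pos : 0 < ω
  e_pos : 0 < e
  η_pos : 0 < η
  e_le : e ≤ 1
  η_le : η ≤ 1
  sq_ω : ω ^ 2 = 2 * E
  speed : ∀ c s y, |c| ≤ 1 → |s| ≤ 1 → |y - 4| ≤ η → 1 / 2 ≤ angularSpeed (b * ω / a ^ 2) e c s y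
  expand : ∀ c s, |c| ≤ 1 → |s| ≤ 1 → ∀ y₁ y₂, |y₁ - 4| ≤ η → |y₂ - 4| ≤ η →
    |polarRate (b * ω / a ^ 2) e c s y₁ - polarRate (b * ω / a ^ 2) e c s y₂ -
      4 * s ^ 2 * (8 * c ^ 2 - 1) * (y₁ - y₂)| ≤ |y₁ - y₂|
  periodic : Function.Periodic Y Real.pi
  deriv : ∀ t, HasDerivAt Y
    (e * polarRate (b * ω / a ^ 2) e (Real.cos t) (Real.sin t) (Y t)) t
  near : ∀ t, |Y t - 4| ≤ η / 2

/-- The variable `y` of the polar equation, as a function on the plane. -/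
noncomputable def scaledSq (a ω e : ℝ) (z : ℝ × ℝ) : ℝ := phaseSq ω z / (ω * e / a)

/-- An integrating factor for the mean-zero part `2 cos 2t - 4 cos 4t` of the linearised rate. -/
noncomputable def floquetWeight (e t : ℝ) : ℝ :=
  Real.exp (-(e * (Real.sin (2 * t) - Real.sin (4 * t))))

/-- Weighted signed distance to the cycle. Thanks to the weight, its modulus grows in forward time
at every angle and not only on average. -/
noncomputable def cycleDefect (a ω e : ℝ) (Y : ℝ → ℝ) (z : ℝ × ℝ) : ℝ :=
  floquetWeight e (phaseAngle ω z) * (scaledSq a ω e z - Y (phaseAngle ω z))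

noncomputable def cyclePoint (a ω e : ℝ) (Y : ℝ → ℝ) (t : ℝ) : ℝ × ℝ :=
  (Real.sqrt (ω * e / a * Y t) * Real.cos t, -(ω * Real.sqrt (ω * e / a * Y t) * Real.sin t))

theorem hasDerivAt_floquetWeight (e t : ℝ) : HasDerivAt (floquetWeight e)
    (floquetWeight e t * -(e * (2 * Real.cos (2 * t) - 4 * Real.cos (4 * t)))) t := by
  have h4 : HasDerivAt (fun t => Real.sin (4 * t)) (Real.cos (4 * t) * 4) t := by
    simpa using ((hasDerivAt_id t).const_mul 4).sin
  have h2 : HasDerivAt (fun t => Real.sin (2 * t)) (Real.cos (2 * t) * 2) t := by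
    simpa using ((hasDerivAt_id t).const_mul 2).sin
  convert! (((h2.sub h4).const_mul e).neg).exp using 1
  simp only [floquetWeight, Pi.neg_apply, Pi.sub_apply]; ring

theorem periodic_floquetWeight (e : ℝ) : Function.Periodic (floquetWeight e) (2 * Real.pi) := by
  intro t
  have e2 : Real.sin (2 * (t + 2 * Real.pi)) = Real.sin (2 * t) := by
    have := Real.sin_add_nat_mul_two_pi (2 * t) 2
    rw [← this]; congr 1; push_cast; ring
  have e4 : Real.sin (4 * (t + 2 * Real.pi)) = Real.sin (4 * t) := by
    have := Real.sin_add_nat_mul_two_pi (4 * t) 4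
    rw [← this]; congr 1; push_cast; ring
  simp only [floquetWeight, e2, e4]

theorem floquetWeight_pos (e t : ℝ) : 0 < floquetWeight e t := Real.exp_pos _

theorem exp_neg_le_floquetWeight {e : ℝ} (he : 0 ≤ e) (t : ℝ) :
    Real.exp (-(2 * e)) ≤ floquetWeight e t := by
  refine Real.exp_le_exp.2 ?_
  nlinarith [Real.sin_le_one (2 * t), Real.neg_one_le_sin (4 * t)]

/-- Splits the limiting derivative of the rate into its mean 2 and the oscillation that
`floquetWeight` removes. -/
theorem four_mul_sin_sq_identity (t : ℝ) :
    4 * Real.sin t ^ 2 * (8 * Real.cos t ^ 2 - 1) -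
      (2 * Real.cos (2 * t) - 4 * Real.cos (4 * t)) = 2 := by
  have e2 : Real.cos (2 * t) = 2 * Real.cos t ^ 2 - 1 := Real.cos_two_mul t
  have e4 : Real.cos (4 * t) = 2 * Real.cos (2 * t) ^ 2 - 1 := by
    rw [← Real.cos_two_mul]; ring_nf
  rw [e4, e2, Real.sin_sq]
  ring

theorem continuous_scaledSq (a ω e : ℝ) : Continuous (scaledSq a ω e) :=
  (continuous_phaseSq ω).div_const _

theorem mem_box_of_phaseSq_le {ω ρ : ℝ} (hω : 0 < ω) (hρ : 0 ≤ ρ) {z : ℝ × ℝ}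
    (hz : phaseSq ω z ≤ 5 * ρ) : z ∈ Icc (-(1 + 5 * ρ)) (1 + 5 * ρ) ×ˢ
      Icc (-(1 + 5 * ρ * ω ^ 2)) (1 + 5 * ρ * ω ^ 2) := by
  unfold phaseSq at hz
  have h3 : z.1 ^ 2 ≤ 5 * ρ := by linarith [sq_nonneg (z.2 / ω)]
  have h4 : z.2 ^ 2 ≤ 5 * ρ * ω ^ 2 := by
    rw [← div_le_iff₀ (by positivity), ← div_pow]; linarith [sq_nonneg z.1]
  have h5 : 0 ≤ 5 * ρ * ω ^ 2 := by positivity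
  refine ⟨abs_le.1 (abs_le_of_sq_le_sq ?_ ?_), abs_le.1 (abs_le_of_sq_le_sq ?_ ?_)⟩ <;>
    nlinarith

/-- A positive periodic speed on the circle is the speed of a motion that winds around the circle
periodically. -/
theorem exists_angle_function {A : ℝ → ℝ} (hA : Continuous A) (hpos : ∀ t, 0 < A t) {p : ℝ}
    (hper : Function.Periodic A p) (hp : 0 < p) : ∃ (σ : ℝ → ℝ) (T : ℝ), 0 < T ∧
      (∀ t, HasDerivAt σ (A (σ t)) t) ∧ (∀ t, σ (t + T) = σ t + p) ∧ Function.Surjective σ := by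
  have hinv : Continuous fun t => (A t)⁻¹ := hA.inv₀ fun t => (hpos t).ne'
  -- The time needed to reach the angle `s`; its inverse is the motion, and `τ p` is the period.
  let τ : ℝ → ℝ := fun s => ∫ t in (0 : ℝ)..s, (A t)⁻¹
  have hτ : ∀ s, HasDerivAt τ (A s)⁻¹ s := fun s => hinv.integral_hasStrictDerivAt 0 s |>.hasDerivAt
  have hmono : StrictMono τ := strictMono_of_hasDerivAt_pos hτ fun s => inv_pos.2 (hpos s)
  have hτc : Continuous τ := continuous_iff_continuousAt.2 fun s => (hτ s).continuousAt
  have hadd : ∀ s, τ (s + p) = τ s + τ p := fun s => by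
    have h1 : Function.Periodic (fun t => (A t)⁻¹) p := fun t => by simp only [hper t]
    have h2 := h1.intervalIntegral_add_eq s 0
    rw [zero_add] at h2
    simp only [τ, ← h2]
    rw [intervalIntegral.integral_add_adjacent_intervals] <;> exact hinv.intervalIntegrable _ _
  have hτ0 : τ 0 = 0 := by simp [τ]
  have hT : 0 < τ p := by rw [← hτ0]; exact hmono hp
  have hmul : ∀ n : ℕ, τ (n * p) = n * τ p ∧ τ (-(n * p)) = -(n * τ p) := fun n => by
    induction n with
    | zero => simp [hτ0]
    | succ n ih =>
      push_cast
      have h1 := hadd (n * p)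
      have h2 := hadd (-((n + 1) * p))
      rw [show -((n + 1) * p) + p = -(n * p) by ring, ih.2] at h2
      rw [show ((n : ℝ) + 1) * p = n * p + p by ring, h1, ih.1]
      refine ⟨by ring, ?_⟩
      rw [show -((n : ℝ) * p + p) = -((n + 1) * p) by ring]
      linarith
  have hsurj : Function.Surjective τ := fun y => by
    obtain ⟨n, hn⟩ := exists_nat_gt (|y| / τ p)
    rw [div_lt_iff₀ hT] at hn
    have hy := abs_lt.1 hn
    obtain ⟨x, -, hx⟩ := intermediate_value_Icc (show -(n * p) ≤ n * p by
      have : 0 ≤ n * p := by positivity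
      linarith) hτc.continuousOn
      (show y ∈ Icc (τ (-(n * p))) (τ (n * p)) by
        rw [(hmul n).1, (hmul n).2]; exact ⟨hy.1.le, hy.2.le⟩)
    exact ⟨x, hx⟩
  let Ψ := (hmono.orderIsoOfSurjective τ hsurj).symm
  have hΨ : ∀ t, τ (Ψ t) = t := fun t => (hmono.orderIsoOfSurjective τ hsurj).apply_symm_apply t
  have hΨ' : ∀ s, Ψ (τ s) = s := fun s => (hmono.orderIsoOfSurjective τ hsurj).symm_apply_apply s
  refine ⟨Ψ, τ p, hT, fun t => ?_, fun t => ?_, Ψ.surjective⟩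
  · have h1 := (hτ (Ψ t)).of_local_left_inverse Ψ.continuous.continuousAt
      (inv_pos.2 (hpos _)).ne' (Eventually.of_forall hΨ)
    simpa using h1
  · apply hmono.injective
    rw [hΨ, hadd, hΨ]

namespace IsPolarCycle

variable {a b E ω e η : ℝ} {Y : ℝ → ℝ}

theorem periodic_two_pi (h : IsPolarCycle a b E ω e η Y) : Function.Periodic Y (2 * Real.pi) := by
  simpa using h.periodic.nat_mul 2

theorem scale_pos (h : IsPolarCycle a b E ω e η Y) : 0 < ω * e / a :=
  div_pos (mul_pos h.ω_pos h.e_pos) h.a_pos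

theorem phaseSq_eq (h : IsPolarCycle a b E ω e η Y) (z : ℝ × ℝ) :
    phaseSq ω z = ω * e / a * scaledSq a ω e z :=
  (mul_div_cancel₀ _ h.scale_pos.ne').symm

theorem three_le (h : IsPolarCycle a b E ω e η Y) (t : ℝ) : 3 ≤ Y t := by
  linarith [(abs_le.1 (h.near t)).1, h.η_le]

theorem le_five (h : IsPolarCycle a b E ω e η Y) (t : ℝ) : Y t ≤ 5 := by
  linarith [(abs_le.1 (h.near t)).2, h.η_le]

theorem damping_eq (h : IsPolarCycle a b E ω e η Y) (c y : ℝ) :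
    -(ω * e) + a * (ω * e / a * y * c ^ 2) - b * ((ω * e / a * y) ^ 2 * c ^ 4) =
      ω * e * dampingCoeff (b * ω / a ^ 2) e c y := by
  have := h.a_pos.ne'
  unfold dampingCoeff
  field_simp

theorem angularSpeed_mul_polarRate (h : IsPolarCycle a b E ω e η Y) {c s y : ℝ}
    (hc : |c| ≤ 1) (hs : |s| ≤ 1) (hy : |y - 4| ≤ η) :
    angularSpeed (b * ω / a ^ 2) e c s y * polarRate (b * ω / a ^ 2) e c s y =
      4 * y * s ^ 2 * dampingCoeff (b * ω / a ^ 2) e c y := by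
  have := h.speed c s y hc hs hy
  unfold polarRate
  rw [mul_div_cancel₀]
  linarith

/-- The vector field in the scaled polar coordinates: the angle. -/
theorem phaseAngleForm_field (h : IsPolarCycle a b E ω e η Y) {z : ℝ × ℝ}
    (hz : 0 < phaseSq ω z) :
    phaseAngleForm ω z (planarField a b E (-(ω * e)) z) = ω * angularSpeed (b * ω / a ^ 2) e
      (Real.cos (phaseAngle ω z)) (Real.sin (phaseAngle ω z)) (scaledSq a ω e z) := by
  have hρ := h.scale_pos
  have hω := h.ω_pos
  obtain ⟨hx, hv⟩ := eq_polar ω hω z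
  set c := Real.cos (phaseAngle ω z)
  set s := Real.sin (phaseAngle ω z)
  have hcs : s ^ 2 + c ^ 2 = 1 := Real.sin_sq_add_cos_sq _
  have hN : phaseSq ω z = ω * e / a * scaledSq a ω e z := h.phaseSq_eq z
  have hd := h.damping_eq c (scaledSq a ω e z)
  rw [← hN] at hd
  have hr2 : Real.sqrt (phaseSq ω z) ^ 2 = phaseSq ω z := Real.sq_sqrt hz.le
  set R := phaseSq ω z
  set r := Real.sqrt R
  have hg : -(ω * e) + a * z.1 ^ 2 - b * z.1 ^ 4 =
      ω * e * dampingCoeff (b * ω / a ^ 2) e c (scaledSq a ω e z) := by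
    rw [← hd, hx, ← hr2]; ring
  have e1 : phaseAngleForm ω z (planarField a b E (-(ω * e)) z) =
      (ω * R)⁻¹ * (z.2 * z.2 - z.1 * (2 * (-(ω * e) + a * z.1 ^ 2 - b * z.1 ^ 4) * z.2
        - 2 * E * z.1)) := by
    simp [phaseAngleForm, planarField, R]
  rw [e1, hg, inv_mul_eq_iff_eq_mul₀ (by positivity), ← h.sq_ω]
  unfold angularSpeed
  set q := dampingCoeff (b * ω / a ^ 2) e c (scaledSq a ω e z)
  rw [hx, hv]
  linear_combination (ω ^ 2 * (s ^ 2 + c ^ 2) + 2 * ω ^ 2 * e * q * c * s) * hr2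
    + ω ^ 2 * R * hcs

/-- The vector field in the scaled polar coordinates: the squared radius. -/
theorem hasFDerivAt_scaledSq (h : IsPolarCycle a b E ω e η Y) {z : ℝ × ℝ}
    (hz : |scaledSq a ω e z - 4| ≤ η) : ∃ N' : ℝ × ℝ →L[ℝ] ℝ,
      HasFDerivAt (scaledSq a ω e) N' z ∧ N' (planarField a b E (-(ω * e)) z) =
        ω * e * (angularSpeed (b * ω / a ^ 2) e (Real.cos (phaseAngle ω z))
          (Real.sin (phaseAngle ω z)) (scaledSq a ω e z) * polarRate (b * ω / a ^ 2) e
            (Real.cos (phaseAngle ω z)) (Real.sin (phaseAngle ω z)) (scaledSq a ω e z)) := by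
  have hρ := h.scale_pos
  have hω := h.ω_pos
  have h1 : HasFDerivAt (fun z : ℝ × ℝ => z.1) (ContinuousLinearMap.fst ℝ ℝ ℝ) z := hasFDerivAt_fst
  have h2 : HasFDerivAt (fun z : ℝ × ℝ => z.2) (ContinuousLinearMap.snd ℝ ℝ ℝ) z := hasFDerivAt_snd
  refine ⟨_, ((h1.pow 2).add ((h2.mul_const ω⁻¹).pow 2)).mul_const (ω * e / a)⁻¹, ?_⟩
  rw [h.angularSpeed_mul_polarRate (Real.abs_cos_le_one _) (Real.abs_sin_le_one _) hz]
  obtain ⟨hx, hv⟩ := eq_polar ω hω z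
  have hR : 0 ≤ phaseSq ω z := by unfold phaseSq; positivity
  set c := Real.cos (phaseAngle ω z)
  set s := Real.sin (phaseAngle ω z)
  have hN : phaseSq ω z = ω * e / a * scaledSq a ω e z := h.phaseSq_eq z
  have hd := h.damping_eq c (scaledSq a ω e z)
  rw [← hN] at hd
  have hr2 : Real.sqrt (phaseSq ω z) ^ 2 = phaseSq ω z := Real.sq_sqrt hR
  set y := scaledSq a ω e z
  set R := phaseSq ω z
  set r := Real.sqrt R
  have hg : -(ω * e) + a * z.1 ^ 2 - b * z.1 ^ 4 =
      ω * e * dampingCoeff (b * ω / a ^ 2) e c y := by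
    rw [← hd, hx, ← hr2]; ring
  set q := dampingCoeff (b * ω / a ^ 2) e c y
  have e1 : (2 * z.1 * z.2 + 2 * (z.2 * ω⁻¹) * ω⁻¹ *
      (2 * (-(ω * e) + a * z.1 ^ 2 - b * z.1 ^ 4) * z.2 - 2 * E * z.1)) * (ω * e / a)⁻¹ =
      ω * e * (4 * y * s ^ 2 * q) := by
    rw [hg, ← h.sq_ω, mul_inv_eq_iff_eq_mul₀ hρ.ne']
    have e2 : ω * e * (4 * y * s ^ 2 * q) * (ω * e / a) = ω * e * (4 * R * s ^ 2 * q) := by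
      rw [hN]; ring
    rw [e2, hx, hv]
    field_simp
    linear_combination (4 * s ^ 2 * e * q) * hr2
  rw [← e1]
  simp [planarField]; ring

/-- Along the flow the distance to the cycle grows. -/
theorem hasFDerivAt_cycleDefect (h : IsPolarCycle a b E ω e η Y) {z : ℝ × ℝ}
    (hz : |scaledSq a ω e z - 4| ≤ η) : ∃ u' : ℝ × ℝ →L[ℝ] ℝ,
      HasFDerivAt (cycleDefect a ω e Y) u' z ∧ ω * e * cycleDefect a ω e Y z ^ 2 ≤
        2 * (cycleDefect a ω e Y z * u' (planarField a b E (-(ω * e)) z)) := by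
  have hω := h.ω_pos
  have he := h.e_pos
  have hR : 0 < phaseSq ω z := by
    have h1 : 0 < scaledSq a ω e z := by linarith [(abs_le.1 hz).1, h.η_le]
    unfold scaledSq at h1
    exact (div_pos_iff_of_pos_right h.scale_pos).1 h1
  obtain ⟨N', hN', hN'f⟩ := h.hasFDerivAt_scaledSq hz
  have hw := hasFDerivAt_comp_phaseAngle (periodic_floquetWeight e) hR
    (hasDerivAt_floquetWeight e (phaseAngle ω z))
  have hYd := hasFDerivAt_comp_phaseAngle h.periodic_two_pi hR (h.deriv (phaseAngle ω z))
  refine ⟨_, hw.mul (hN'.sub hYd), ?_⟩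
  have hform := h.phaseAngleForm_field hR
  simp only [add_apply, smul_apply, sub_apply, smul_eq_mul, hN'f, hform]
  unfold cycleDefect
  set θ := phaseAngle ω z
  set y := scaledSq a ω e z
  have hA := h.speed (Real.cos θ) (Real.sin θ) y (Real.abs_cos_le_one _) (Real.abs_sin_le_one _) hz
  have hexp := h.expand (Real.cos θ) (Real.sin θ) (Real.abs_cos_le_one _) (Real.abs_sin_le_one _)
    y (Y θ) hz ((h.near θ).trans (by linarith [h.η_pos]))
  have hid := four_mul_sin_sq_identity θ
  set A := angularSpeed (b * ω / a ^ 2) e (Real.cos θ) (Real.sin θ) y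
  set G := polarRate (b * ω / a ^ 2) e (Real.cos θ) (Real.sin θ) y
  set G₀ := polarRate (b * ω / a ^ 2) e (Real.cos θ) (Real.sin θ) (Y θ)
  set g := 4 * Real.sin θ ^ 2 * (8 * Real.cos θ ^ 2 - 1)
  set q := 2 * Real.cos (2 * θ) - 4 * Real.cos (4 * θ)
  set m := floquetWeight e θ
  -- The mean expansion 2, less the error 1 allowed by `expand`, leaves rate 1; the bound `1 / 2` on
  -- the angular speed then enters below.
  have hprod : (y - Y θ) ^ 2 ≤ (y - Y θ) * (G - G₀ - q * (y - Y θ)) := by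
    have h1 : |(y - Y θ) * (G - G₀ - g * (y - Y θ))| ≤ (y - Y θ) ^ 2 := by
      rw [abs_mul, ← sq_abs (y - Y θ), sq]
      exact mul_le_mul_of_nonneg_left hexp (abs_nonneg _)
    have h2 := (abs_le.1 h1).1
    have h3 : g = q + 2 := by linarith
    rw [h3] at h2
    linarith
  have hk : 0 ≤ ω * e * m ^ 2 := by positivity
  calc ω * e * (m * (y - Y θ)) ^ 2 = ω * e * m ^ 2 * (2 * (1 / 2) * (y - Y θ) ^ 2) := by ring
    _ ≤ ω * e * m ^ 2 * (2 * A * ((y - Y θ) * (G - G₀ - q * (y - Y θ)))) := by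
        refine mul_le_mul_of_nonneg_left ?_ hk
        exact mul_le_mul (by linarith) hprod (sq_nonneg _) (by linarith)
    _ = _ := by ring

/-- The threshold below which the cycle's Lyapunov function decays. -/
theorem abs_scaledSq_sub_le (h : IsPolarCycle a b E ω e η Y) {z : ℝ × ℝ}
    (hz : cycleDefect a ω e Y z ^ 2 < (η / 2 * Real.exp (-(2 * e))) ^ 2) :
    |scaledSq a ω e z - 4| < η := by
  have hη := h.η_pos
  have h1 := abs_lt_of_sq_lt_sq hz (by positivity)
  unfold cycleDefect at h1
  rw [abs_mul, abs_of_pos (floquetWeight_pos _ _)] at h1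
  have h2 := exp_neg_le_floquetWeight h.e_pos.le (phaseAngle ω z)
  have h3 : |scaledSq a ω e z - Y (phaseAngle ω z)| < η / 2 := by
    by_contra! hcon
    have := mul_le_mul h2 hcon (by positivity) (floquetWeight_pos e _).le
    linarith
  calc |scaledSq a ω e z - 4| ≤ |scaledSq a ω e z - Y (phaseAngle ω z)| +
        |Y (phaseAngle ω z) - 4| := abs_sub_le _ _ _
    _ < η := by linarith [h.near (phaseAngle ω z)]

/-- The squared defect need not be continuous at the origin, where the angle is undefined.
Truncation at the threshold repairs this: wherever `scaledSq < 3` the minimum is constant. Below the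
threshold the point lies in the band `|y - 4| < η`, where the expansion estimate holds. -/
theorem isStrictLyapunov (h : IsPolarCycle a b E ω e η Y) :
    IsStrictLyapunov (fun z => -planarField a b E (-(ω * e)) z)
      (fun z => min (cycleDefect a ω e Y z ^ 2) ((η / 2 * Real.exp (-(2 * e))) ^ 2))
      ((η / 2 * Real.exp (-(2 * e))) ^ 2) (ω * e) := by
  have hη := h.η_pos
  have hω := h.ω_pos
  have he := h.e_pos
  have hρ := h.scale_pos
  set κ := (η / 2 * Real.exp (-(2 * e))) ^ 2 with hκ_def
  have hκ : 0 < κ := by positivity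
  have hcont : Continuous fun z => min (cycleDefect a ω e Y z ^ 2) κ := by
    refine continuous_iff_continuousAt.2 fun z => ?_
    rcases lt_or_ge (scaledSq a ω e z) 3 with hz | hz
    · refine ContinuousAt.congr (f := fun _ => κ) continuousAt_const ?_
      filter_upwards [(isOpen_lt (continuous_scaledSq a ω e) continuous_const).mem_nhds hz]
        with w hw
      refine (min_eq_right ?_).symm
      by_contra! hlt
      have h1 := (abs_lt.1 (h.abs_scaledSq_sub_le hlt)).1
      have h2 : scaledSq a ω e w < 3 := hw
      linarith [h.η_le]
    · have hR : 0 < phaseSq ω z := by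
        unfold scaledSq at hz
        exact (div_pos_iff_of_pos_right hρ).1 (by linarith)
      have hw := hasFDerivAt_comp_phaseAngle (periodic_floquetWeight e) hR
        (hasDerivAt_floquetWeight e (phaseAngle ω z))
      have hYd := hasFDerivAt_comp_phaseAngle h.periodic_two_pi hR (h.deriv (phaseAngle ω z))
      have hu : ContinuousAt (cycleDefect a ω e Y) z :=
        hw.continuousAt.mul ((continuous_scaledSq a ω e).continuousAt.sub hYd.continuousAt)
      exact (hu.pow 2).min continuousAt_const
  refine ⟨hcont, fun z => le_min (sq_nonneg _) hκ.le, hκ, by positivity, fun k hk => ?_,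
    fun z hz => ?_⟩
  · have hcl : IsClosed {z : ℝ × ℝ | min (cycleDefect a ω e Y z ^ 2) κ ≤ k} :=
      isClosed_le hcont continuous_const
    refine IsCompact.of_isClosed_subset
      (isCompact_Icc.prod isCompact_Icc : IsCompact
        (Icc (-(1 + 5 * (ω * e / a))) (1 + 5 * (ω * e / a)) ×ˢ
          Icc (-(1 + 5 * (ω * e / a) * ω ^ 2)) (1 + 5 * (ω * e / a) * ω ^ 2))) hcl fun z hz => ?_
    have hlt : cycleDefect a ω e Y z ^ 2 < κ := by
      rcases min_le_iff.1 (show min (cycleDefect a ω e Y z ^ 2) κ ≤ k from hz) with h1 | h1 <;>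
        linarith
    have h1 := (abs_lt.1 (h.abs_scaledSq_sub_le hlt)).2
    have h2 : phaseSq ω z ≤ 5 * (ω * e / a) := by
      rw [← div_le_iff₀ hρ]
      change scaledSq a ω e z ≤ 5
      linarith [h.η_le]
    exact mem_box_of_phaseSq_le hω hρ.le h2
  · have hlt : cycleDefect a ω e Y z ^ 2 < κ := by
      rcases min_lt_iff.1 hz with h1 | h1
      · exact h1
      · exact absurd h1 (lt_irrefl _)
    obtain ⟨u', hu', hle⟩ := h.hasFDerivAt_cycleDefect (h.abs_scaledSq_sub_le hlt).le
    have hev : (fun z => min (cycleDefect a ω e Y z ^ 2) κ) =ᶠ[𝓝 z]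
        fun z => cycleDefect a ω e Y z ^ 2 := by
      filter_upwards [(hu'.continuousAt.pow 2).eventually_lt continuousAt_const hlt] with w hw
      exact min_eq_left hw.le
    refine ⟨_, (hu'.pow 2).congr_of_eventuallyEq hev, ?_⟩
    have h1 : min (cycleDefect a ω e Y z ^ 2) κ = cycleDefect a ω e Y z ^ 2 := min_eq_left hlt.le
    rw [h1]
    simp
    linarith

end IsPolarCycle

end Cycle

/-! ### The cycle as a closed orbit: amplitude, instability, position and isolation. -/

section Cycle

namespace IsPolarCycle

variable {a b E ω e η : ℝ} {Y : ℝ → ℝ}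

theorem radicand_pos (h : IsPolarCycle a b E ω e η Y) (t : ℝ) : 0 < ω * e / a * Y t :=
  mul_pos h.scale_pos (by linarith [h.three_le t])

theorem cyclePoint_mem_iff (h : IsPolarCycle a b E ω e η Y) (z : ℝ × ℝ) :
    min (cycleDefect a ω e Y z ^ 2) ((η / 2 * Real.exp (-(2 * e))) ^ 2) = 0 ↔
      z ∈ range (cyclePoint a ω e Y) := by
  have hη := h.η_pos
  have hκ : 0 < (η / 2 * Real.exp (-(2 * e))) ^ 2 := by positivity
  constructor
  · intro h0
    have h1 : cycleDefect a ω e Y z ^ 2 = 0 := by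
      rcases min_choice (cycleDefect a ω e Y z ^ 2) ((η / 2 * Real.exp (-(2 * e))) ^ 2) with h2 | h2
      · exact h2.symm.trans h0
      · exact absurd (h2.symm.trans h0) hκ.ne'
    have h2 : scaledSq a ω e z = Y (phaseAngle ω z) := by
      have h3 := pow_eq_zero_iff two_ne_zero |>.1 h1
      unfold cycleDefect at h3
      rcases mul_eq_zero.1 h3 with h4 | h4
      · exact absurd h4 (floquetWeight_pos _ _).ne'
      · linarith
    obtain ⟨hx, hv⟩ := eq_polar ω h.ω_pos z
    refine ⟨phaseAngle ω z, ?_⟩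
    rw [cyclePoint, ← h2, ← h.phaseSq_eq]
    exact Prod.ext hx.symm hv.symm
  · rintro ⟨t, rfl⟩
    have hpos := h.radicand_pos t
    have h1 : Y (phaseAngle ω (cyclePoint a ω e Y t)) = Y t :=
      apply_phaseAngle_polar h.periodic_two_pi h.ω_pos (Real.sqrt_pos.2 hpos) t
    have h2 : scaledSq a ω e (cyclePoint a ω e Y t) = Y t := by
      unfold scaledSq cyclePoint
      rw [phaseSq_polar h.ω_pos, Real.sq_sqrt hpos.le, mul_div_cancel_left₀ _ h.scale_pos.ne']
    have h3 : cycleDefect a ω e Y (cyclePoint a ω e Y t) = 0 := by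
      rw [cycleDefect, h1, h2, sub_self, mul_zero]
    rw [h3]
    simpa using hκ.le

theorem zeroSet_eq (h : IsPolarCycle a b E ω e η Y) :
    {z | min (cycleDefect a ω e Y z ^ 2) ((η / 2 * Real.exp (-(2 * e))) ^ 2) = 0} =
      range (cyclePoint a ω e Y) :=
  Set.ext h.cyclePoint_mem_iff

theorem isRepellingSet (h : IsPolarCycle a b E ω e η Y) :
    IsRepellingSet (planarField a b E (-(ω * e))) (range (cyclePoint a ω e Y)) := by
  rw [← h.zeroSet_eq]
  exact h.isStrictLyapunov.isAsymptoticallyStableSet (contDiff_planarField a b E _).neg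

/-- The turning points have angle `n π`, and `Y` takes the same value at all of these by
`π`-periodicity. -/
theorem hasAmplitude (h : IsPolarCycle a b E ω e η Y) :
    HasAmplitude (range (cyclePoint a ω e Y)) (Real.sqrt (ω * e / a * Y 0)) := by
  refine ⟨⟨Real.sqrt (ω * e / a * Y 0), 0, by simp [cyclePoint]⟩, ?_⟩
  rintro ψ ⟨t, ht⟩
  have hpos := Real.sqrt_pos.2 (h.radicand_pos t)
  have h1 : Real.sqrt (ω * e / a * Y t) * Real.cos t = ψ := congrArg Prod.fst ht
  have h2 : -(ω * Real.sqrt (ω * e / a * Y t) * Real.sin t) = 0 := congrArg Prod.snd ht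
  have h3 : Real.sin t = 0 := by
    have := mul_pos h.ω_pos hpos
    rcases mul_eq_zero.1 (neg_eq_zero.1 h2) with h4 | h4
    · exact absurd h4 this.ne'
    · exact h4
  obtain ⟨n, hn⟩ := Real.sin_eq_zero_iff.1 h3
  have h4 : Y t = Y 0 := by rw [← hn]; simpa using h.periodic.int_mul n 0
  have h5 : |Real.cos t| = 1 := by
    have := Real.sin_sq_add_cos_sq t
    rw [h3] at this
    rw [← sq_eq_sq₀ (abs_nonneg _) zero_le_one, sq_abs]; linarith
  rw [← h1, abs_mul, h5, mul_one, h4, abs_of_nonneg (Real.sqrt_nonneg _)]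

/-- Backward attraction excludes stability once the cycle has a limit point of its complement: the
points `(x, 0)` with `x > A` lie off the cycle and accumulate at `(A, 0)`. -/
theorem not_isStableSet (h : IsPolarCycle a b E ω e η Y) :
    ¬ IsStableSet (planarField a b E (-(ω * e))) (range (cyclePoint a ω e Y)) := by
  have hamp := h.hasAmplitude
  set A := Real.sqrt (ω * e / a * Y 0)
  have hA : 0 < A := Real.sqrt_pos.2 (h.radicand_pos 0)
  refine h.isRepellingSet.2.not_isStableSet_neg (z := (A, 0)) ⟨0, by simp [cyclePoint, A]⟩ ?_
  refine map_mem_closure (f := fun x : ℝ => ((x, 0) : ℝ × ℝ)) (s := Ioi A) (by fun_prop)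
    (by rw [closure_Ioi]; exact self_mem_Ici) fun x (hx : A < x) hmem => ?_
  have h1 := hamp.2 x hmem
  rw [abs_of_pos (hA.trans hx)] at h1
  exact hx.ne' h1

theorem phaseSq_le (h : IsPolarCycle a b E ω e η Y) {z : ℝ × ℝ}
    (hz : z ∈ range (cyclePoint a ω e Y)) : phaseSq ω z ≤ 5 * (ω * e / a) := by
  obtain ⟨t, rfl⟩ := hz
  unfold cyclePoint
  rw [phaseSq_polar h.ω_pos, Real.sq_sqrt (h.radicand_pos t).le]
  nlinarith [h.scale_pos, h.le_five t]

/-- The sign of `scaledSq - Y(θ)` separates inside from outside: both sign regions are open, the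
zero set lies on the cycle, and the negative region is bounded and contains the origin. -/
theorem surrounds (h : IsPolarCycle a b E ω e η Y) :
    Surrounds (range (cyclePoint a ω e Y)) 0 := by
  have hρ := h.scale_pos
  have hω := h.ω_pos
  let D : ℝ × ℝ → ℝ := fun z => scaledSq a ω e z - Y (phaseAngle ω z)
  have hDcont : ∀ z, z ≠ 0 → ContinuousAt D z := fun z hz =>
    (continuous_scaledSq a ω e).continuousAt.sub
      (hasFDerivAt_comp_phaseAngle h.periodic_two_pi (phaseSq_pos hω hz) (h.deriv _)).continuousAt
  have hN0 : scaledSq a ω e 0 = 0 := by simp [scaledSq, phaseSq]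
  have hD0 : D 0 < 0 := by
    have := h.three_le (phaseAngle ω 0)
    simp only [D, hN0]; linarith
  have hmem : ∀ z, D z = 0 → z ∈ range (cyclePoint a ω e Y) := fun z hz => by
    rw [← h.cyclePoint_mem_iff]
    have : cycleDefect a ω e Y z = 0 := by
      unfold cycleDefect; exact mul_eq_zero_of_right _ hz
    rw [this]
    simpa using sq_nonneg (η / 2 * Real.exp (-(2 * e)))
  have hnot : (0 : ℝ × ℝ) ∉ range (cyclePoint a ω e Y) := by
    rintro ⟨t, ht⟩
    have h1 : phaseSq ω (cyclePoint a ω e Y t) = 0 := by rw [ht]; simp [phaseSq]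
    unfold cyclePoint at h1
    rw [phaseSq_polar hω, Real.sq_sqrt (h.radicand_pos t).le] at h1
    exact (h.radicand_pos t).ne' h1
  have hneg : IsOpen {z | D z < 0} := isOpen_iff_mem_nhds.2 fun z hz => by
    rcases eq_or_ne z 0 with rfl | hz0
    · filter_upwards [(isOpen_lt (continuous_scaledSq a ω e) continuous_const).mem_nhds
        (show scaledSq a ω e 0 < 3 by rw [hN0]; norm_num)] with w hw
      have h1 : scaledSq a ω e w < 3 := hw
      have h2 := h.three_le (phaseAngle ω w)
      show scaledSq a ω e w - Y (phaseAngle ω w) < 0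
      linarith
    · exact (hDcont z hz0).eventually_lt continuousAt_const hz
  have hpos : IsOpen {z | 0 < D z} := isOpen_iff_mem_nhds.2 fun z hz => by
    have hz0 : z ≠ 0 := by
      rintro rfl
      exact lt_asymm hz hD0
    exact continuousAt_const.eventually_lt (hDcont z hz0) hz
  refine ⟨hnot, ?_⟩
  have hsub : connectedComponentIn (range (cyclePoint a ω e Y))ᶜ 0 ⊆ {z | D z < 0} := by
    refine isPreconnected_connectedComponentIn.subset_left_of_subset_union hneg hpos ?_ ?_ ?_
    · exact Set.disjoint_left.2 fun z (h1 : D z < 0) (h2 : 0 < D z) => lt_asymm h1 h2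
    · intro z hz
      rcases lt_trichotomy (D z) 0 with h1 | h1 | h1
      · exact Or.inl h1
      · exact absurd (hmem z h1) (connectedComponentIn_subset _ _ hz)
      · exact Or.inr h1
    · exact ⟨0, mem_connectedComponentIn hnot, hD0⟩
  have hbdd : Bornology.IsBounded
      (Icc (-(1 + 5 * (ω * e / a))) (1 + 5 * (ω * e / a)) ×ˢ
        Icc (-(1 + 5 * (ω * e / a) * ω ^ 2)) (1 + 5 * (ω * e / a) * ω ^ 2)) :=
    (isCompact_Icc.prod isCompact_Icc).isBounded
  refine hbdd.subset (hsub.trans fun z hz => ?_)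
  have h1 : scaledSq a ω e z - Y (phaseAngle ω z) < 0 := hz
  have h2 : phaseSq ω z ≤ 5 * (ω * e / a) := by
    rw [← div_le_iff₀ hρ]
    change scaledSq a ω e z ≤ 5
    linarith [h.le_five (phaseAngle ω z)]
  exact mem_box_of_phaseSq_le hω hρ.le h2

/-- The curve `cyclePoint`, run with the angular speed of the system, solves the system. -/
theorem hasDerivAt_cyclePoint (h : IsPolarCycle a b E ω e η Y) (t : ℝ) :
    ∃ p' : ℝ × ℝ, HasDerivAt (cyclePoint a ω e Y) p' t ∧
      (ω * angularSpeed (b * ω / a ^ 2) e (Real.cos t) (Real.sin t) (Y t)) • p' =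
        planarField a b E (-(ω * e)) (cyclePoint a ω e Y t) := by
  have hρ := h.scale_pos
  have hω := h.ω_pos
  have hpos := h.radicand_pos t
  have hnear : |Y t - 4| ≤ η := (h.near t).trans (by linarith [h.η_pos])
  have hAG := h.angularSpeed_mul_polarRate (Real.abs_cos_le_one t) (Real.abs_sin_le_one t) hnear
  have hr := ((h.deriv t).const_mul (ω * e / a)).sqrt hpos.ne'
  refine ⟨_, (hr.mul (Real.hasDerivAt_cos t)).prodMk
    (((hr.const_mul ω).mul (Real.hasDerivAt_sin t)).neg), ?_⟩
  have hd := h.damping_eq (Real.cos t) (Y t)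
  have hr2 : Real.sqrt (ω * e / a * Y t) ^ 2 = ω * e / a * Y t := Real.sq_sqrt hpos.le
  have hr0 : 0 < Real.sqrt (ω * e / a * Y t) := Real.sqrt_pos.2 hpos
  have hcs : Real.sin t ^ 2 + Real.cos t ^ 2 = 1 := Real.sin_sq_add_cos_sq t
  have hA : angularSpeed (b * ω / a ^ 2) e (Real.cos t) (Real.sin t) (Y t) = 1 + 2 * e *
    (Real.sin t * Real.cos t) * dampingCoeff (b * ω / a ^ 2) e (Real.cos t) (Y t) := rfl
  unfold cyclePoint planarField
  rw [← hr2] at hd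
  set A := angularSpeed (b * ω / a ^ 2) e (Real.cos t) (Real.sin t) (Y t)
  set G := polarRate (b * ω / a ^ 2) e (Real.cos t) (Real.sin t) (Y t)
  set q := dampingCoeff (b * ω / a ^ 2) e (Real.cos t) (Y t)
  set r := Real.sqrt (ω * e / a * Y t)
  set c := Real.cos t
  set s := Real.sin t
  have hrad : A * (ω * e / a * (e * G) / (2 * r)) = 2 * e * r * s ^ 2 * q := by
    rw [← mul_div_assoc, div_eq_iff (by positivity)]
    linear_combination (ω * e / a * e) * hAG - 4 * e * s ^ 2 * q * hr2
  set ρ' := ω * e / a * (e * G) / (2 * r)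
  have hg : -(ω * e) + a * (r * c) ^ 2 - b * (r * c) ^ 4 = ω * e * q := by
    rw [← hd]; ring
  refine Prod.ext ?_ ?_
  · simp only [Prod.smul_fst, smul_eq_mul]
    linear_combination (ω * c) * hrad - ω * r * s * hA
  · simp only [Prod.smul_snd, smul_eq_mul]
    rw [hg, ← h.sq_ω]
    linear_combination (-(ω ^ 2 * s)) * hrad - ω ^ 2 * r * c * hA
      - 2 * ω ^ 2 * e * r * s * q * hcs

theorem isPeriodicOrbit (h : IsPolarCycle a b E ω e η Y) :
    IsPeriodicOrbit (planarField a b E (-(ω * e))) (range (cyclePoint a ω e Y)) := by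
  have hω := h.ω_pos
  let A : ℝ → ℝ := fun t => ω * angularSpeed (b * ω / a ^ 2) e (Real.cos t) (Real.sin t) (Y t)
  have hYc : Continuous Y := continuous_iff_continuousAt.2 fun t => (h.deriv t).continuousAt
  have hAc : Continuous A := by
    simp only [A]; unfold angularSpeed dampingCoeff; fun_prop
  have hAlow : ∀ t, ω / 2 ≤ A t := fun t => by
    have := h.speed _ _ (Y t) (Real.abs_cos_le_one t) (Real.abs_sin_le_one t)
      ((h.near t).trans (by linarith [h.η_pos]))
    simp only [A]; nlinarith
  have hApos : ∀ t, 0 < A t := fun t => by linarith [hAlow t]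
  have hAper : Function.Periodic A (2 * Real.pi) := fun t => by
    simp only [A, Real.cos_add_two_pi, Real.sin_add_two_pi, h.periodic_two_pi t]
  obtain ⟨σ, T, hT, hσ, hσT, hσsurj⟩ := exists_angle_function hAc hApos hAper Real.two_pi_pos
  have hper : Function.Periodic (cyclePoint a ω e Y) (2 * Real.pi) := fun t => by
    simp only [cyclePoint, Real.cos_add_two_pi, Real.sin_add_two_pi, h.periodic_two_pi t]
  refine ⟨fun t => cyclePoint a ω e Y (σ t), T, hT, fun t => ?_, fun t => ?_, ?_, ?_⟩
  · obtain ⟨p', hp', hf⟩ := h.hasDerivAt_cyclePoint (σ t)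
    simp only
    rw [← hf]
    exact hp'.scomp t (hσ t)
  · simp only [hσT, hper (σ t)]
  -- Half a turn later the motion is at the antipodal point, which differs since the cycle avoids
  -- the origin.
  · obtain ⟨t, ht⟩ := hσsurj (σ 0 + Real.pi)
    refine ⟨t, fun heq => ?_⟩
    simp only [ht] at heq
    have h1 := congrArg Prod.fst heq
    have h2 := congrArg Prod.snd heq
    simp only [cyclePoint, Real.cos_add_pi, Real.sin_add_pi, h.periodic (σ 0)] at h1 h2
    have hr := Real.sqrt_pos.2 (h.radicand_pos (σ 0))
    have hcs := Real.sin_sq_add_cos_sq (σ 0)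
    set r := Real.sqrt (ω * e / a * Y (σ 0))
    have h3 : r * Real.cos (σ 0) = 0 := by linarith
    have h4 : ω * r * Real.sin (σ 0) = 0 := by linarith
    have h5 : Real.cos (σ 0) = 0 := (mul_eq_zero.1 h3).resolve_left hr.ne'
    have h6 : Real.sin (σ 0) = 0 := (mul_eq_zero.1 h4).resolve_left (mul_pos hω hr).ne'
    simp [h5, h6] at hcs
  · exact hσsurj.range_comp (cyclePoint a ω e Y)

theorem isLimitCycle (h : IsPolarCycle a b E ω e η Y) :
    IsLimitCycle (planarField a b E (-(ω * e))) (range (cyclePoint a ω e Y)) := by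
  have h1 := h.isStrictLyapunov.isLimitCycle (contDiff_planarField a b E _)
  rw [h.zeroSet_eq] at h1
  exact h1 h.isPeriodicOrbit

end IsPolarCycle

end Cycle

/-! ### Assembly, with `e = -γ / ω`. -/

theorem mainTheorem3 (a b E : ℝ) (ha : 0 < a) (hb : 0 < b) (hE : 0 < E) :
    IsHopfBifurcation (planarField a b E) 0 0 (Real.sqrt (2 * E)) ∧
    ∃ ε : ℝ, 0 < ε ∧ ∃ (Γin : ℝ → Set (ℝ × ℝ)) (Ain : ℝ → ℝ),
      (∀ γ ∈ Ioo (-ε) 0, IsAsymptoticallyStableSet (planarField a b E γ) {0}) ∧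
      (∀ γ ∈ Ioo 0 ε, ¬ IsStableSet (planarField a b E γ) {0}) ∧
      (∀ γ ∈ Ioo (-ε) 0,
        IsLimitCycle (planarField a b E γ) (Γin γ) ∧
        Surrounds (Γin γ) 0 ∧
        ¬ IsStableSet (planarField a b E γ) (Γin γ) ∧
        IsRepellingSet (planarField a b E γ) (Γin γ) ∧
        HasAmplitude (Γin γ) (Ain γ)) ∧
      (∀ U ∈ 𝓝 (0 : ℝ × ℝ), ∀ᶠ γ in 𝓝[<] (0 : ℝ), Γin γ ⊆ U) ∧
      (fun γ => Ain γ ^ 2 - (-4 * γ / a)) =O[𝓝[<] (0 : ℝ)] (fun γ => γ ^ 2) := by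
  refine ⟨isHopfBifurcation_planarField a b hE, ?_⟩
  set ω := Real.sqrt (2 * E) with hω_def
  have hω : 0 < ω := Real.sqrt_pos.2 (by positivity)
  have hω2 : ω ^ 2 = 2 * E := Real.sq_sqrt (by positivity)
  obtain ⟨e₀, he₀, η, hη, C, hη1, hsol⟩ :=
    exists_periodic_polar_solution (k := b * ω / a ^ 2) (by positivity)
  have hcyc : ∀ γ ∈ Ioo (-(ω * e₀)) 0, ∃ Y : ℝ → ℝ,
      IsPolarCycle a b E ω (-γ / ω) η Y ∧ |Y 0 - 4| ≤ C * (-γ / ω) := by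
    intro γ hγ
    have he : 0 < -γ / ω := div_pos (by linarith [hγ.2]) hω
    have hee : -γ / ω < e₀ := by rw [div_lt_iff₀ hω]; linarith [hγ.1]
    obtain ⟨⟨h1, h2⟩, h3, Y, h4, h5, h6, h7⟩ := hsol _ he hee
    exact ⟨Y, ⟨ha, hω, he, hη, h1, hη1, hω2, h2, h3, h4, h5, h6⟩, h7⟩
  choose! Y hY hY0 using hcyc
  -- The first bound is `e < e₀`, needed for the cycle; the second is `γ² ≤ E/32`, needed at the
  -- origin.
  set ε := min (ω * e₀) (Real.sqrt (E / 32)) with hε_def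
  have hε : 0 < ε := lt_min (by positivity) (Real.sqrt_pos.2 (by positivity))
  have hsmall : ∀ γ, |γ| < ε → γ ^ 2 ≤ E / 32 := fun γ hγ => by
    rw [← sq_abs]
    exact (Real.le_sqrt (abs_nonneg γ) (by positivity)).1 (hγ.le.trans (min_le_right _ _))
  have hmem : ∀ γ ∈ Ioo (-ε) 0, γ ∈ Ioo (-(ω * e₀)) 0 := fun γ hγ =>
    ⟨by linarith [hγ.1, min_le_left (ω * e₀) (Real.sqrt (E / 32))], hγ.2⟩
  have hγe : ∀ γ, -(ω * (-γ / ω)) = γ := fun γ => by field_simp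
  have hev : ∀ᶠ γ in 𝓝[<] (0 : ℝ), γ ∈ Ioo (-ε) 0 :=
    Ioo_mem_nhdsLT (by linarith)
  refine ⟨ε, hε, fun γ => range (cyclePoint a ω (-γ / ω) (Y γ)),
    fun γ => Real.sqrt (ω * (-γ / ω) / a * Y γ 0), fun γ hγ => ?_, fun γ hγ => ?_, fun γ hγ => ?_,
    fun U hU => ?_, ?_⟩
  · exact isAsymptoticallyStableSet_zero ha hb hE hγ.2
      (hsmall γ (by rw [abs_of_neg hγ.2]; linarith [hγ.1]))
  · exact not_isStableSet_zero ha hb hE hγ.1 (hsmall γ (by rw [abs_of_pos hγ.1]; exact hγ.2))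
  · have h := hY γ (hmem γ hγ)
    have h1 := h.isLimitCycle
    have h2 := h.not_isStableSet
    have h3 := h.isRepellingSet
    rw [hγe] at h1 h2 h3
    exact ⟨h1, h.surrounds, h2, h3, h.hasAmplitude⟩
  · obtain ⟨ρ, hρ, hball⟩ := Metric.mem_nhds_iff.1 hU
    -- The factor `1 + ω²` controls `ψ²` and `v²` at once.
    have hlim : ∀ᶠ γ : ℝ in 𝓝 0, 5 * (-γ / a) * (1 + ω ^ 2) < ρ ^ 2 :=
      ContinuousAt.eventually_lt (by fun_prop) continuousAt_const (by simpa using by positivity)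
    filter_upwards [hev, hlim.filter_mono nhdsWithin_le_nhds] with γ hγ hγρ z hz
    apply hball
    have h := (hY γ (hmem γ hγ)).phaseSq_le hz
    have e1 : ω * (-γ / ω) / a = -γ / a := by field_simp
    rw [e1] at h
    have hpos : 0 < -γ / a := div_pos (by linarith [hγ.2]) ha
    unfold phaseSq at h
    have hx : z.1 ^ 2 < ρ ^ 2 := by nlinarith [sq_nonneg (z.2 / ω), sq_nonneg ω]
    have hv : z.2 ^ 2 < ρ ^ 2 := by
      have h1 : (z.2 / ω) ^ 2 ≤ 5 * (-γ / a) := by linarith [sq_nonneg z.1]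
      rw [div_pow, div_le_iff₀ (by positivity)] at h1
      nlinarith
    rw [Metric.mem_ball, dist_zero_right, Prod.norm_def, max_lt_iff, Real.norm_eq_abs,
      Real.norm_eq_abs]
    exact ⟨abs_lt_of_sq_lt_sq hx hρ.le, abs_lt_of_sq_lt_sq hv hρ.le⟩
  · refine IsBigO.of_bound (C / (a * ω)) ?_
    filter_upwards [hev] with γ hγ
    have h := hY γ (hmem γ hγ)
    have h0 := hY0 γ (hmem γ hγ)
    rw [Real.sq_sqrt (h.radicand_pos 0).le, Real.norm_eq_abs, Real.norm_eq_abs, abs_of_nonneg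
      (sq_nonneg γ)]
    -- The amplitude error is a product of two factors of order `γ`: the scale `-γ/a` and `Y 0 - 4`,
    -- which is at most `C e` in modulus.
    have e1 : ω * (-γ / ω) / a * Y γ 0 - -4 * γ / a = -γ / a * (Y γ 0 - 4) := by field_simp; ring
    have hpos : 0 < -γ / a := div_pos (by linarith [hγ.2]) ha
    rw [e1, abs_mul, abs_of_pos hpos]
    calc -γ / a * |Y γ 0 - 4| ≤ -γ / a * (C * (-γ / ω)) := mul_le_mul_of_nonneg_left h0 hpos.le
      _ = _ := by field_simp
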